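/- Let $N\ge 1$ be an integer, let $A,B,Q\in\mathbb R$ with $Q<0$, and let $\alpha,\beta\in\{1,-1\}$. For $\varepsilon>0$ put $q=e^{Q/\varepsilon}$, $c_1=\alpha e^{A/\varepsilon}$, $c_2=\beta e^{B/\varepsilon}$, $(q^2;q^2)_n=\prod_{i=1}^n(1-q^{2i})$, and for $m\in\mathbb Z$ $$a(m)=(-1)^{m(m-1)/2}\sum_{n\ge 0}\frac{(-1)^n(-q)^{n(n+1)/2}}{(q^2;q^2)_n}(-q)^{mn},\qquad b(m)=(-1)^{m(m+1)/2}\sum_{n\ge 0}\frac{(-q)^{n(n+1)/2}}{(q^2;q^2)_n}(-q)^{mn}$$ (the $q$-Ai and $q$-Bi functions at $q^m$), $w(m)=c_1a(m)+c_2b(m)$, and $$g^{(N)}(m)=\det\bigl(w(m-i+2j)\bigr)_{0\le i,j\le N-1}.$$ We say that the p-ultradiscrete analogue of $g^{(N)}(m)$ is $(\gamma,G)$, with $\gamma\in\{1,-1\}$ and $G\in\mathbb R$, and write $(\gamma^{(N)}(m),G^{(N)}(m))=(\gamma,G)$, if there is a constant $d>0$ with $g^{(N)}(m)=\gamma e^{G/\varepsilon}(d+o(1))$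 as $\varepsilon\to+0$ (so $g^{(N)}(m)$ has sign $\gamma$ for small $\varepsilon$ and $\varepsilon\log|g^{(N)}(m)|\to G$). For $0\le k\le N$ set $$\gamma_k^{(N)}(m)=\alpha^{N-k}\beta^k(-1)^{Nk-k(k+1)/2},$$ $$G_k^{(N)}(m)=(N-k)A+kB+\Bigl[\bigl(-k+\tfrac N2\bigr)m^2+\bigl\{-3k^2+(2N+1)k+\tfrac{N(N-2)}2\bigr\}m-\tfrac83k^3+\bigl(2N+\tfrac32\bigr)k^2+\bigl(-N+\tfrac16\bigr)k+\tfrac{N(N-1)(N-2)}6\Bigr]Q .$$ (The pairs with $k=0$ and $k=N$ are the uAi-type and uBi-type terms.) Let $m_0$ be an integer with $$m_0\le\min\bigl(-3N+1,\,-N(N-1)/2-1\bigr),\qquad m_0^2Q\le B-A<(m_0+1)^2Q,$$ and put $P'_0=(m_0+1)^2Q$ and $P'_j=\bigl(m_0^2-(N-j)(N-j+1)\bigr)Q$ for $1\le j\le N$. Then there is exactly one $k_0\in\{0,\dots,N-1\}$ with $P'_{k_0+1}\le B-A<P'_{k_0}$, and for every integer $m\le-2N+1$ the following holds. (I) If $m\le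 m_0-2N+2$, then $(\gamma^{(N)}(m),G^{(N)}(m))=(\gamma_N^{(N)}(m),G_N^{(N)}(m))$. (II) If $m_0-2N+3\le m\le m_0+N-1$, then there is exactly one $j\in\{0,\dots,N-1\}$ such that $$m\in\begin{cases}\{m_0+N-3j,\;m_0+N-3j+1,\;m_0+N-3j+2\}&(k_0+1\le j\le N-1)\\ \{m_0+N-3j,\;m_0+N-3j+1\}&(j=k_0)\\ \{m_0+N-3j-1,\;m_0+N-3j,\;m_0+N-3j+1\}&(0\le j\le k_0-1),\end{cases}$$ and for this $j$ we have $(\gamma^{(N)}(m),G^{(N)}(m))=(\gamma_j^{(N)}(m),G_j^{(N)}(m))$. (III) If $m_0+N\le m\le-2N+1$, then $(\gamma^{(N)}(m),G^{(N)}(m))=(\gamma_0^{(N)}(m),G_0^{(N)}(m))$. -/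

import Mathlib

open Filter Topology

noncomputable section

/-- The `q`-shifted factorial `(q²; q²)_n = (1 - q²)(1 - q⁴) ⋯ (1 - q^{2n})`. -/
def qFactSq (q : ℝ) (n : ℕ) : ℝ :=
  ∏ i ∈ Finset.range n, (1 - q ^ (2 * (i + 1)))

/-- The `q`-Ai function at `τ = q^m`:
`(-1)^{m(m-1)/2} ∑_{n ≥ 0} (-1)^n (-q)^{n(n+1)/2} (-q)^{mn} / (q²; q²)_n`.
The series converges absolutely for `0 < q < 1`. -/
def qAi (q : ℝ) (m : ℤ) : ℝ :=
  (-1 : ℝ) ^ (m * (m - 1) / 2) *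
    ∑' n : ℕ, (-1 : ℝ) ^ n * (-q) ^ (n * (n + 1) / 2) / qFactSq q n * (-q) ^ (m * (n : ℤ))

/-- The `q`-Bi function at `τ = q^m`:
`(-1)^{m(m+1)/2} ∑_{n ≥ 0} (-q)^{n(n+1)/2} (-q)^{mn} / (q²; q²)_n`. -/
def qBi (q : ℝ) (m : ℤ) : ℝ :=
  (-1 : ℝ) ^ (m * (m + 1) / 2) *
    ∑' n : ℕ, (-q) ^ (n * (n + 1) / 2) / qFactSq q n * (-q) ^ (m * (n : ℤ))

/-- The seed `w(m) = c₁ q-Ai(q^m) + c₂ q-Bi(q^m)`. -/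
def seed (q c₁ c₂ : ℝ) (m : ℤ) : ℝ :=
  c₁ * qAi q m + c₂ * qBi q m

/-- The determinant `g^{(N)}(m) = det (w(m - i + 2j))_{0 ≤ i, j ≤ N-1}` (equal to `1` for
`N = 0`), with `w` the seed. -/
def gDet (q c₁ c₂ : ℝ) (N : ℕ) (m : ℤ) : ℝ :=
  (Matrix.of fun i j : Fin N => seed q c₁ c₂ (m - ((i : ℕ) : ℤ) + 2 * ((j : ℕ) : ℤ))).det

/-- `g^{(N)}(m)` as a function of the ultradiscretization parameter `ε`, with
`q = e^{Q/ε}`, `c₁ = α e^{A/ε}`, `c₂ = β e^{B/ε}`. -/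
def gEps (A B Q : ℝ) (α β : ℤˣ) (N : ℕ) (m : ℤ) (ε : ℝ) : ℝ :=
  gDet (Real.exp (Q / ε)) (((α : ℤ) : ℝ) * Real.exp (A / ε)) (((β : ℤ) : ℝ) * Real.exp (B / ε)) N m

/-- `(γ, G)` is the p-ultradiscrete analogue (limit with parity variable) of the function `x(ε)`:
`x(ε)` has the leading term `γ e^{G/ε}` up to a positive constant, i.e.
`x(ε) = γ e^{G/ε} (d + o(1))` as `ε → +0` for some constant `d > 0`. In particular `x(ε)` has the
sign `γ` for small `ε > 0`, and `ε log |x(ε)| → G`. -/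
def IsPUltradiscrete (x : ℝ → ℝ) (γ : ℤˣ) (G : ℝ) : Prop :=
  ∃ d : ℝ, 0 < d ∧
    Tendsto (fun ε : ℝ => x ε / (((γ : ℤ) : ℝ) * Real.exp (G / ε))) (𝓝[>] 0) (𝓝 d)

/-- The sign `γ_k^{(N)}` of the leading term of `c₁^{N-k} c₂^k g_k^{(N)}(m)`:
`α^{N-k} β^k (-1)^{Nk - k(k+1)/2}`. It does not depend on `m`. -/
def gammaTerm (α β : ℤˣ) (N k : ℕ) : ℤˣ :=
  α ^ (N - k) * β ^ k * (-1) ^ (N * k - k * (k + 1) / 2)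

/-- The amplitude `G_k^{(N)}(m)` of the leading term of `c₁^{N-k} c₂^k g_k^{(N)}(m)`. -/
def GTerm (A B Q : ℝ) (N k : ℕ) (m : ℤ) : ℝ :=
  ((N : ℝ) - k) * A + k * B +
    ((-(k : ℝ) + N / 2) * (m : ℝ) ^ 2
      + (-3 * (k : ℝ) ^ 2 + (2 * N + 1) * k + N * ((N : ℝ) - 2) / 2) * m
      - 8 / 3 * (k : ℝ) ^ 3 + (2 * N + 3 / 2) * (k : ℝ) ^ 2 + (-(N : ℝ) + 1 / 6) * k
      + N * ((N : ℝ) - 1) * ((N : ℝ) - 2) / 6) * Q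

/-- The thresholds `P'_0 = (m₀ + 1)² Q` and `P'_j = (m₀² - (N - j)(N - j + 1)) Q` for
`1 ≤ j ≤ N`. -/
def PThreshold (Q : ℝ) (N : ℕ) (m₀ : ℤ) (j : ℕ) : ℝ :=
  if j = 0 then ((m₀ : ℝ) + 1) ^ 2 * Q
  else ((m₀ : ℝ) ^ 2 - ((N : ℝ) - j) * ((N : ℝ) - j + 1)) * Q

/-- `k₀ ∈ {0, …, N - 1}` and `P'_{k₀+1} ≤ B - A < P'_{k₀}`. -/
def IsThresholdIndex (A B Q : ℝ) (N : ℕ) (m₀ : ℤ) (k₀ : ℕ) : Prop :=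
  k₀ < N ∧ PThreshold Q N m₀ (k₀ + 1) ≤ B - A ∧ B - A < PThreshold Q N m₀ k₀

/-- `m` lies in the block of consecutive integers with index `j ∈ {0, …, N - 1}`. -/
def InBlock (N : ℕ) (m₀ : ℤ) (k₀ j : ℕ) (m : ℤ) : Prop :=
  (k₀ + 1 ≤ j ∧ j + 1 ≤ N ∧
    (m = m₀ + N - 3 * j ∨ m = m₀ + N - 3 * j + 1 ∨ m = m₀ + N - 3 * j + 2)) ∨
  (j = k₀ ∧ (m = m₀ + N - 3 * j ∨ m = m₀ + N - 3 * j + 1)) ∨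
  (j + 1 ≤ k₀ ∧
    (m = m₀ + N - 3 * j - 1 ∨ m = m₀ + N - 3 * j ∨ m = m₀ + N - 3 * j + 1))

end

/-!
The two functions solve the recurrence `w(l + 1) + w(l - 1) = q^l w(l)`. At negative integers `q`-Bi
is the dominant solution, `qBi q l ~ 2 q^{-l(l+1)/2}` as `q → 0`, which is read off from the two
largest terms of its series (`tendsto_qBi`). For `q`-Ai the series cancels completely, and the
leading term `qAi q l ~ q^{l(l-1)/2}` comes from another source: for fixed small `q` the ratio
`qAi / qBi` tends to `0` at `-∞` (the limiting theta series is odd,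
`tendsto_airySum_neg_one_atBot`), its increments are given by the constant Casoratian, which tends
to `2`, and so `qAi q l * qBi q (l - 1) → 2` (`tendsto_qAi_mul_qBi`, `tendsto_qAi`).

Expanding the determinant by multilinearity and the Leibniz formula gives finitely many terms, indexed
by a permutation and by the set of columns that carry `q`-Bi. Among the terms with `k` factors
`q`-Bi exactly one has the least order in `q`: exchanging two rows or two columns improves every
other one (`termVal_extremal_lt`). It has the columns `0, …, k - 1` of type `q`-Bi, in the last
`k` rows and in reversed order, and the remaining columns in their natural order. Hence the part
of degree `k` has the leading term `γ_k 2^k e^{G_k / ε}` without cancellation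
(`hasLeadingTerm_homogeneousPart`).

Finally `G_{k+1} - G_k = B - A - crossing N (k + 1) m * Q`, where `crossing N k m` decreases in `k`.
So `G_k` is maximal at the `j` with `crossing N j m * Q ≤ B - A < crossing N (j + 1) m * Q`. If
several amplitudes tie, the highest degree `j` still fixes the sign, since `2^j > ∑_{k < j} 2^k`
(`isPUltradiscrete_of_dominant`). The regions for `m` are exactly those in which a given `j`
satisfies these inequalities (`crossing_of_inBlock`).
-/

noncomputable section

/-! ### Triangular exponents and the two-sided series -/

/-- The triangular number `l (l + 1) / 2` of an integer. -/
def tri (l : ℤ) : ℤ := l * (l + 1) / 2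

lemma two_mul_tri (l : ℤ) : 2 * tri l = l * (l + 1) :=
  Int.mul_ediv_cancel' (Int.even_mul_succ_self l).two_dvd

lemma tri_eq_of {l t : ℤ} (h : 2 * t = l * (l + 1)) : tri l = t := by
  have := two_mul_tri l
  omega

lemma tri_natCast (n : ℕ) : tri n = ((n * (n + 1) / 2 : ℕ) : ℤ) := by
  simp [tri]

lemma abs_sub_one_le_tri (j : ℤ) : |j| - 1 ≤ tri j := by
  have h := two_mul_tri j
  rcases abs_cases j with ⟨h1, h2⟩ | ⟨h1, h2⟩ <;> rw [h1]
  · nlinarith [sq_nonneg (j - 1)]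
  · rcases eq_or_lt_of_le (show j ≤ -1 by omega) with rfl | h3
    · norm_num [tri]
    · nlinarith

lemma tri_nonneg (j : ℤ) : 0 ≤ tri j := by
  have h := abs_sub_one_le_tri j
  rcases eq_or_ne j 0 with rfl | hj
  · simp [tri]
  · have := Int.one_le_abs hj
    omega

lemma tri_pos {j : ℤ} (h0 : j ≠ 0) (h1 : j ≠ -1) : 0 < tri j := by
  have h := two_mul_tri j
  rcases lt_or_gt_of_ne h0 with h2 | h2
  · have : j ≤ -2 := by omega
    nlinarith
  · nlinarith

/-- The reciprocal `1 / (q²; q²)_n`, extended by `0` to negative `n`. -/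
def recipQFact (q : ℝ) (n : ℤ) : ℝ :=
  if 0 ≤ n then (qFactSq q n.toNat)⁻¹ else 0

/-- The common normalisation of both functions: `∑_{j ∈ ℤ} s^j (-q)^{j(j+1)/2} / (q²; q²)_{j-l}`.
Up to the factor `q^{-l(l+1)/2}` it is `q`-Ai at `q^l` for `s = -1` and `q`-Bi for `s = 1`. -/
def airySum (s : ℤˣ) (q : ℝ) (l : ℤ) : ℝ :=
  ∑' j : ℤ, (((s ^ j : ℤˣ) : ℤ) : ℝ) * (-q) ^ tri j * recipQFact q (j - l)

lemma qFactSq_succ (q : ℝ) (n : ℕ) :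
    qFactSq q (n + 1) = qFactSq q n * (1 - q ^ (2 * (n + 1))) := by
  simp [qFactSq, Finset.prod_range_succ]

/-- The stronger bound with the summand `q^{2n}` is what makes the induction close. -/
lemma half_le_qFactSq {q : ℝ} (h0 : 0 < q) (h1 : q ≤ 1 / 2) (n : ℕ) :
    (1 + q ^ (2 * n)) / 2 ≤ qFactSq q n := by
  induction n with
  | zero => simp [qFactSq]
  | succ n ih =>
    rw [qFactSq_succ]
    have hx : q ^ 2 ≤ 1 / 4 := by nlinarith
    have hy0 : 0 < q ^ (2 * n) := by positivity
    have hy1 : q ^ (2 * n) ≤ 1 := pow_le_one₀ h0.le (by linarith)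
    have e : q ^ (2 * (n + 1)) = q ^ (2 * n) * q ^ 2 := by ring
    rw [e]
    set y := q ^ (2 * n)
    have hx0 : 0 < q ^ 2 := by positivity
    set x := q ^ 2
    have hxy : y * x ≤ 1 / 4 := by nlinarith
    calc (1 + y * x) / 2 ≤ (1 + y) / 2 * (1 - y * x) := by
          nlinarith [mul_nonneg hy0.le (show 0 ≤ 1 - 2 * x - y * x by linarith)]
      _ ≤ _ := by gcongr; linarith

lemma recipQFact_nonneg {q : ℝ} (h0 : 0 < q) (h1 : q ≤ 1 / 2) (n : ℤ) : 0 ≤ recipQFact q n := by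
  unfold recipQFact
  split_ifs
  · have := half_le_qFactSq h0 h1 n.toNat
    have : 0 < q ^ (2 * n.toNat) := by positivity
    exact inv_nonneg.2 (by linarith)
  · exact le_rfl

lemma recipQFact_le_two {q : ℝ} (h0 : 0 < q) (h1 : q ≤ 1 / 2) (n : ℤ) : recipQFact q n ≤ 2 := by
  unfold recipQFact
  split_ifs
  · have := half_le_qFactSq h0 h1 n.toNat
    have : 0 < q ^ (2 * n.toNat) := by positivity
    exact (inv_le_comm₀ (by linarith) (by norm_num)).2 (by linarith)
  · norm_num

/-- Valid for all integers `n`, because `1 - q^{2n}` vanishes at `n = 0`. -/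
lemma recipQFact_sub {q : ℝ} (h0 : 0 < q) (h1 : q ≤ 1 / 2) (n : ℤ) :
    recipQFact q n - recipQFact q (n - 1) = q ^ (2 * n) * recipQFact q n := by
  rcases lt_trichotomy n 0 with h | rfl | h
  · simp [recipQFact, not_le.2 h, show ¬ (1 ≤ n) by omega]
  · simp [recipQFact, qFactSq]
  · obtain ⟨k, rfl⟩ : ∃ k : ℕ, n = k + 1 := ⟨(n - 1).toNat, by omega⟩
    have hk := half_le_qFactSq h0 h1 k
    have hk1 := half_le_qFactSq h0 h1 (k + 1)
    have p1 : 0 < q ^ (2 * k) := by positivity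
    have p2 : 0 < q ^ (2 * (k + 1)) := by positivity
    have e1 : recipQFact q ((k : ℤ) + 1) = (qFactSq q (k + 1))⁻¹ := by
      rw [recipQFact, if_pos (by omega)]; congr 1
    have e2 : recipQFact q ((k : ℤ) + 1 - 1) = (qFactSq q k)⁻¹ := by
      rw [recipQFact, if_pos (by omega)]; congr 2; omega
    have e3 : q ^ (2 * ((k : ℤ) + 1)) = q ^ (2 * (k + 1)) := by
      rw [← zpow_natCast]; congr 1
    rw [e1, e2, e3]
    rw [qFactSq_succ] at hk1 ⊢
    have n1 : qFactSq q k ≠ 0 := by intro h; rw [h] at hk; linarith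
    have n2 : 1 - q ^ (2 * (k + 1)) ≠ 0 := by intro h; rw [h] at hk1; linarith
    field_simp
    ring

lemma abs_units_cast (u : ℤˣ) : |((u : ℤ) : ℝ)| = 1 := by
  rcases Int.units_eq_one_or u with rfl | rfl <;> simp

lemma summable_half_pow_tri : Summable fun j : ℤ => (1 / 2 : ℝ) ^ tri j * 2 := by
  apply Summable.mul_right
  have hb (j : ℤ) : (1 / 2 : ℝ) ^ tri j ≤ 2 * (1 / 2 : ℝ) ^ j.natAbs := by
    have : 2 * (1 / 2 : ℝ) ^ j.natAbs = (1 / 2 : ℝ) ^ (|j| - 1) := by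
      rw [zpow_sub₀ (by norm_num), Int.abs_eq_natAbs, zpow_natCast]
      norm_num
      ring
    rw [this]
    exact zpow_le_zpow_right_of_le_one₀ (by norm_num) (by norm_num) (abs_sub_one_le_tri j)
  refine Summable.of_nonneg_of_le (fun _ => by positivity) hb (Summable.mul_left _ ?_)
  have hg : Summable fun n : ℕ => (1 / 2 : ℝ) ^ n :=
    summable_geometric_of_lt_one (by norm_num) (by norm_num)
  exact Summable.of_nat_of_neg (by simpa using hg) (by simpa using hg)

lemma norm_airyTerm_le {q : ℝ} (h0 : 0 < q) (h1 : q ≤ 1 / 2) (u : ℤˣ) (j n : ℤ) :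
    ‖((u : ℤ) : ℝ) * (-q) ^ tri j * recipQFact q n‖ ≤ (1 / 2 : ℝ) ^ tri j * 2 := by
  rw [norm_mul, norm_mul, Real.norm_eq_abs, abs_units_cast, one_mul, norm_zpow, norm_neg,
    Real.norm_of_nonneg h0.le, Real.norm_of_nonneg (recipQFact_nonneg h0 h1 n)]
  gcongr
  · exact recipQFact_nonneg h0 h1 n
  · obtain ⟨k, hk⟩ := Int.eq_ofNat_of_zero_le (tri_nonneg j)
    rw [hk, zpow_natCast, zpow_natCast]
    gcongr
  · exact recipQFact_le_two h0 h1 n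

lemma summable_airyTerm {q : ℝ} (h0 : 0 < q) (h1 : q ≤ 1 / 2) (s : ℤˣ) (l : ℤ) :
    Summable fun j : ℤ =>
      (((s ^ j : ℤˣ) : ℤ) : ℝ) * (-q) ^ tri j * recipQFact q (j - l) :=
  Summable.of_norm_bounded summable_half_pow_tri fun _ => norm_airyTerm_le h0 h1 _ _ _

lemma units_zpow_add_two (s : ℤˣ) (j : ℤ) : s ^ (j + 2) = s ^ j := by
  rw [zpow_add, show (2 : ℤ) = ((2 : ℕ) : ℤ) from rfl, zpow_natCast, Int.units_sq, mul_one]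

/-- The three-term recurrence in normalised form, from `recipQFact_sub` and the shift
`j ↦ j + 2`. -/
lemma airySum_sub_one {q : ℝ} (h0 : 0 < q) (h1 : q ≤ 1 / 2) (s : ℤˣ) (l : ℤ) :
    airySum s q (l - 1) = airySum s q l - q ^ (-2 * l - 1) * airySum s q (l + 1) := by
  have hp : (-q) ≠ 0 := by simpa using h0.ne'
  have key : airySum s q (l - 1) - airySum s q l = -q ^ (-2 * l - 1) * airySum s q (l + 1) := by
    unfold airySum
    rw [← (summable_airyTerm h0 h1 s _).tsum_sub (summable_airyTerm h0 h1 s _),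
      ← (Equiv.addRight (2 : ℤ)).tsum_eq (fun j : ℤ =>
      (((s ^ j : ℤˣ) : ℤ) : ℝ) * (-q) ^ tri j * recipQFact q (j - (l + 1))), ← tsum_mul_left]
    refine tsum_congr fun j => ?_
    have e := recipQFact_sub h0 h1 (j - l + 1)
    rw [show j - l + 1 - 1 = j - l by ring] at e
    simp only [Equiv.coe_addRight, units_zpow_add_two]
    rw [show j - (l - 1) = j - l + 1 by ring, show j + 2 - (l + 1) = j - l + 1 by ring,
      ← mul_sub, e,
      tri_eq_of (l := j + 2) (t := tri j + (2 * j + 3)) (by have := two_mul_tri j; linarith),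
      zpow_add₀ hp]
    have e2 : q ^ (2 * (j - l + 1)) = - q ^ (-2 * l - 1) * (-q) ^ (2 * j + 3) := by
      rw [Odd.neg_zpow ⟨j + 1, by ring⟩, neg_mul_neg, ← zpow_add₀ h0.ne']
      congr 1; ring
    rw [e2]; ring
  linarith

/-- The one-sided series of `q`-Ai and `q`-Bi is the two-sided one, completed by zero terms. -/
lemma tsum_nat_eq_airySum {q : ℝ} (h0 : 0 < q) (s : ℤˣ) (l : ℤ) :
    ∑' n : ℕ, (((s ^ n : ℤˣ) : ℤ) : ℝ) * ((-q) ^ (n * (n + 1) / 2) / qFactSq q n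
      * (-q) ^ (l * (n : ℤ))) =
    (((s ^ l : ℤˣ) : ℤ) : ℝ) * (-q) ^ (-tri l) * airySum s q l := by
  have hp : (-q) ≠ 0 := by simpa using h0.ne'
  have hinj : Function.Injective fun n : ℕ => (n : ℤ) + l := fun a b h => by simpa using h
  unfold airySum
  rw [← hinj.tsum_eq, ← tsum_mul_left]
  · refine tsum_congr fun n => ?_
    rw [tri_eq_of (l := (n : ℤ) + l) (t := tri n + l * n + tri l)
      (by have := two_mul_tri l; have := two_mul_tri n; linarith), zpow_add₀ hp, zpow_add₀ hp,
      tri_natCast, zpow_natCast, zpow_neg]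
    have e1 : recipQFact q ((n : ℤ) + l - l) = (qFactSq q n)⁻¹ := by
      rw [recipQFact, if_pos (by omega)]; congr 2; omega
    have e2 : s ^ l * s ^ ((n : ℤ) + l) = s ^ n := by
      rw [zpow_add, mul_comm, mul_assoc, ← sq, Int.units_sq, mul_one, zpow_natCast]
    rw [e1, ← e2]
    push_cast
    field_simp
  · intro j hj
    by_contra hcon
    apply hj
    have : ¬ 0 ≤ j - l := fun h => hcon ⟨(j - l).toNat, by simp; omega⟩
    have h2 : recipQFact q (j - l) = 0 := if_neg this
    simp only [h2, mul_zero]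

lemma neg_one_zpow_mul_neg_zpow {q : ℝ} (e : ℤ) : (-1 : ℝ) ^ e * (-q) ^ (-e) = q ^ (-e) := by
  rw [neg_eq_neg_one_mul q, mul_zpow, ← mul_assoc, ← zpow_add₀ (by norm_num)]
  simp

lemma qBi_eq_airySum {q : ℝ} (h0 : 0 < q) (l : ℤ) :
    qBi q l = q ^ (-tri l) * airySum 1 q l := by
  have h := tsum_nat_eq_airySum h0 1 l
  simp only [one_pow, one_zpow, Units.val_one, Int.cast_one, one_mul] at h
  rw [qBi, h, ← mul_assoc, ← neg_one_zpow_mul_neg_zpow (q := q), tri]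

lemma qAi_eq_airySum {q : ℝ} (h0 : 0 < q) (l : ℤ) :
    qAi q l = q ^ (-tri l) * airySum (-1) q l := by
  have h := tsum_nat_eq_airySum h0 (-1) l
  have e (n : ℕ) : (-1 : ℝ) ^ n * (-q) ^ (n * (n + 1) / 2) / qFactSq q n * (-q) ^ (l * (n : ℤ)) =
      ((((-1) ^ n : ℤˣ) : ℤ) : ℝ) * ((-q) ^ (n * (n + 1) / 2) / qFactSq q n
      * (-q) ^ (l * (n : ℤ))) := by
    push_cast; ring
  have e2 : ((((-1) ^ l : ℤˣ) : ℤ) : ℝ) = (-1 : ℝ) ^ l := by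
    rcases Int.even_or_odd l with h | h
    · rw [h.neg_one_zpow, h.neg_one_zpow]; simp
    · rw [h.neg_one_zpow, h.neg_one_zpow]; simp
  have e3 : l * (l - 1) / 2 + l = tri l := by
    rw [tri, ← Int.add_mul_ediv_right _ _ (by norm_num)]; congr 1; ring
  rw [qAi, tsum_congr e, h, e2, ← mul_assoc, ← mul_assoc, ← zpow_add₀ (by norm_num), e3,
    neg_one_zpow_mul_neg_zpow]

lemma qBi_recurrence {q : ℝ} (h0 : 0 < q) (h1 : q ≤ 1 / 2) (l : ℤ) :
    qBi q (l - 1) = q ^ l * qBi q l - qBi q (l + 1) := by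
  rw [qBi_eq_airySum h0, qBi_eq_airySum h0, qBi_eq_airySum h0, airySum_sub_one h0 h1, mul_sub,
    ← mul_assoc, ← mul_assoc, ← zpow_add₀ h0.ne', ← zpow_add₀ h0.ne']
  have := two_mul_tri l
  have e1 : tri (l - 1) = tri l - l := tri_eq_of (by linarith)
  have e2 : tri (l + 1) = tri l + l + 1 := tri_eq_of (by linarith)
  rw [e1, e2]
  ring_nf

lemma qAi_recurrence {q : ℝ} (h0 : 0 < q) (h1 : q ≤ 1 / 2) (l : ℤ) :
    qAi q (l - 1) = q ^ l * qAi q l - qAi q (l + 1) := by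
  rw [qAi_eq_airySum h0, qAi_eq_airySum h0, qAi_eq_airySum h0, airySum_sub_one h0 h1, mul_sub,
    ← mul_assoc, ← mul_assoc, ← zpow_add₀ h0.ne', ← zpow_add₀ h0.ne']
  have := two_mul_tri l
  have e1 : tri (l - 1) = tri l - l := tri_eq_of (by linarith)
  have e2 : tri (l + 1) = tri l + l + 1 := tri_eq_of (by linarith)
  rw [e1, e2]
  ring_nf

/-! ### Leading behaviour of `q`-Ai and `q`-Bi at negative integers -/

lemma eventually_pos_le (r : ℝ) (hr : 0 < r) : ∀ᶠ q : ℝ in 𝓝[>] 0, 0 < q ∧ q ≤ r := by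
  filter_upwards [Ioc_mem_nhdsGT hr] with q hq using hq

lemma tendsto_zpow_nhdsGT_zero {n : ℤ} (hn : 0 < n) :
    Tendsto (fun q : ℝ => q ^ n) (𝓝[>] 0) (𝓝 0) := by
  obtain ⟨k, rfl⟩ := Int.eq_ofNat_of_zero_le hn.le
  have : Tendsto (fun q : ℝ => q ^ k) (𝓝 0) (𝓝 (0 ^ k)) := (continuous_pow k).tendsto 0
  rw [zero_pow (by omega)] at this
  simpa using this.mono_left nhdsWithin_le_nhds

lemma tendsto_recipQFact (n : ℤ) :
    Tendsto (fun q => recipQFact q n) (𝓝[>] 0) (𝓝 (if 0 ≤ n then 1 else 0)) := by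
  unfold recipQFact
  split_ifs
  · have hc : Continuous fun q : ℝ => qFactSq q n.toNat := by unfold qFactSq; fun_prop
    have h := hc.tendsto 0
    have e : qFactSq 0 n.toNat = 1 := by simp [qFactSq]
    rw [e] at h
    simpa using (h.mono_left nhdsWithin_le_nhds).inv₀ one_ne_zero
  · exact tendsto_const_nhds

/-- Only the terms with `j (j + 1) / 2 = 0`, that is `j = 0` and `j = -1`, survive as `q → 0`. -/
lemma tendsto_airySum_nhdsGT_zero (s : ℤˣ) (l : ℤ) :
    Tendsto (fun q => airySum s q l) (𝓝[>] 0)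
      (𝓝 ((if l ≤ 0 then 1 else 0) + ((s : ℤ) : ℝ) * (if l ≤ -1 then 1 else 0))) := by
  set g : ℤ → ℝ := fun j => (((s ^ j : ℤˣ) : ℤ) : ℝ) * (if tri j = 0 then 1 else 0) *
    (if 0 ≤ j - l then 1 else 0) with hg
  have hsum : ∑' j, g j =
      (if l ≤ 0 then 1 else 0) + ((s : ℤ) : ℝ) * (if l ≤ -1 then 1 else 0) := by
    rw [tsum_eq_sum (s := {0, -1}), Finset.sum_pair (by norm_num)]
    · have t0 : tri 0 = 0 := by simp [tri]
      have t1 : tri (-1) = 0 := by simp [tri]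
      have h1 : (0 ≤ -1 - l) ↔ l ≤ -1 := by omega
      simp only [hg, t0, t1, zero_sub, h1]
      rcases Int.units_eq_one_or s with rfl | rfl <;> simp
    · intro j hj
      simp only [Finset.mem_insert, Finset.mem_singleton, not_or] at hj
      simp [hg, (tri_pos hj.1 hj.2).ne']
  rw [← hsum]
  refine tendsto_tsum_of_dominated_convergence summable_half_pow_tri (fun j => ?_) ?_
  · refine Tendsto.mul (Tendsto.mul tendsto_const_nhds ?_) ?_
    · split_ifs with h
      · simp [h]
      · have hp : 0 < tri j := lt_of_le_of_ne (tri_nonneg j) (Ne.symm h)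
        rw [tendsto_zero_iff_abs_tendsto_zero]
        refine (tendsto_zpow_nhdsGT_zero hp).congr' ?_
        filter_upwards [self_mem_nhdsWithin] with q hq
        simp [abs_zpow, abs_of_pos (show (0 : ℝ) < q from hq)]
    · simpa using tendsto_recipQFact (j - l)
  · filter_upwards [eventually_pos_le (1 / 2) (by norm_num)] with q hq j
    exact norm_airyTerm_le hq.1 hq.2 _ _ _

lemma tendsto_recipQFact_atTop {q : ℝ} (h0 : 0 < q) (h1 : q ≤ 1 / 2) :
    ∃ c, Tendsto (fun n : ℤ => recipQFact q n) atTop (𝓝 c) := by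
  have hmono : Monotone fun n : ℤ => recipQFact q n := by
    refine monotone_int_of_le_succ fun n => ?_
    have h := recipQFact_sub h0 h1 (n + 1)
    rw [add_sub_cancel_right] at h
    have := recipQFact_nonneg h0 h1 (n + 1)
    have : 0 ≤ q ^ (2 * (n + 1)) * recipQFact q (n + 1) := by positivity
    linarith
  exact ⟨_, tendsto_atTop_ciSup hmono ⟨2, by rintro _ ⟨n, rfl⟩; exact recipQFact_le_two h0 h1 n⟩⟩

/-- The limiting theta series `∑_j (-1)^j (-q)^{j(j+1)/2}` is odd under `j ↦ -1 - j`, hence zero.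
This is why `q`-Ai is the recessive solution at `-∞`. -/
lemma tendsto_airySum_neg_one_atBot {q : ℝ} (h0 : 0 < q) (h1 : q ≤ 1 / 2) :
    Tendsto (fun l => airySum (-1) q l) atBot (𝓝 0) := by
  obtain ⟨c, hc⟩ := tendsto_recipQFact_atTop h0 h1
  set g : ℤ → ℝ := fun j => ((((-1) ^ j : ℤˣ) : ℤ) : ℝ) * (-q) ^ tri j * c with hg
  have hodd : ∑' j, g j = -∑' j, g j := by
    conv_lhs => rw [← (Equiv.subLeft (-1 : ℤ)).tsum_eq g]
    rw [← tsum_neg]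
    refine tsum_congr fun j => ?_
    have e1 : tri (-1 - j) = tri j := tri_eq_of (by have := two_mul_tri j; linarith)
    have e2 : ((-1) ^ (-1 - j) : ℤˣ) = -(-1) ^ j := by
      rw [zpow_sub]; rcases Int.even_or_odd j with h | h <;> rw [h.neg_one_zpow] <;> simp
    simp only [hg, Equiv.subLeft_apply, e1, e2]
    push_cast
    ring
  have hzero : ∑' j, g j = 0 := by linarith
  rw [← hzero]
  refine tendsto_tsum_of_dominated_convergence summable_half_pow_tri (fun j => ?_) ?_
  · refine Tendsto.mul tendsto_const_nhds (hc.comp ?_)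
    exact tendsto_atTop_add_const_left _ j tendsto_neg_atBot_atTop
  · exact Eventually.of_forall fun l j => norm_airyTerm_le h0 h1 _ _ _

lemma casoratian_const {q : ℝ} (h0 : 0 < q) (h1 : q ≤ 1 / 2) (l : ℤ) :
    qAi q l * qBi q (l + 1) - qAi q (l + 1) * qBi q l =
      qAi q (-1) * qBi q 0 - qAi q 0 * qBi q (-1) := by
  have step (l : ℤ) : qAi q (l - 1) * qBi q l - qAi q l * qBi q (l - 1) =
      qAi q l * qBi q (l + 1) - qAi q (l + 1) * qBi q l := by
    rw [qAi_recurrence h0 h1, qBi_recurrence h0 h1]; ring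
  induction l using Int.induction_on with
  | zero => have := step 0; norm_num at this ⊢; linarith
  | succ n ih => have := step (n + 1); rw [add_sub_cancel_right] at this; linarith
  | pred n ih => have := step (-n); rw [sub_add_cancel]; linarith

/-- The conditions on a fixed `q` under which `q`-Ai and `q`-Bi are controlled at all negative
integers simultaneously; they hold for all sufficiently small `q > 0`. -/
structure IsSmallBase (q : ℝ) : Prop where
  pos : 0 < q
  le_third : q ≤ 1 / 3
  zero_pos : 0 < qBi q 0
  zero_le : qBi q 0 ≤ qBi q (-1)
  casoratian_nonneg : 0 ≤ qAi q 0 * qBi q (-1) - qAi q (-1) * qBi q 0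

lemma tri_zero : tri 0 = 0 := by simp [tri]
lemma tri_neg_one : tri (-1) = 0 := by simp [tri]

lemma tendsto_qBi_zero : Tendsto (fun q => qBi q 0) (𝓝[>] 0) (𝓝 1) := by
  have h := tendsto_airySum_nhdsGT_zero 1 0
  norm_num at h
  refine h.congr' ?_
  filter_upwards [self_mem_nhdsWithin] with q hq
  simp [qBi_eq_airySum hq, tri_zero]

lemma tendsto_qBi_neg_one : Tendsto (fun q => qBi q (-1)) (𝓝[>] 0) (𝓝 2) := by
  have h := tendsto_airySum_nhdsGT_zero 1 (-1)
  norm_num at h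
  refine h.congr' ?_
  filter_upwards [self_mem_nhdsWithin] with q hq
  simp [qBi_eq_airySum hq, tri_neg_one]

lemma tendsto_casoratian :
    Tendsto (fun q => qAi q 0 * qBi q (-1) - qAi q (-1) * qBi q 0) (𝓝[>] 0) (𝓝 2) := by
  have h0 := tendsto_airySum_nhdsGT_zero (-1) 0
  have h1 := tendsto_airySum_nhdsGT_zero (-1) (-1)
  norm_num at h0 h1
  have h := (h0.mul tendsto_qBi_neg_one).sub (h1.mul tendsto_qBi_zero)
  norm_num at h
  refine h.congr' ?_
  filter_upwards [self_mem_nhdsWithin] with q hq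
  simp [qAi_eq_airySum hq, tri_neg_one, tri_zero]

lemma eventually_isSmallBase : ∀ᶠ q : ℝ in 𝓝[>] 0, IsSmallBase q := by
  filter_upwards [eventually_pos_le (1 / 3) (by norm_num),
    tendsto_qBi_zero.eventually (Ioo_mem_nhds (show (0 : ℝ) < 1 by norm_num)
      (show (1 : ℝ) < 3 / 2 by norm_num)),
    tendsto_qBi_neg_one.eventually (lt_mem_nhds (show (3 / 2 : ℝ) < 2 by norm_num)),
    tendsto_casoratian.eventually (lt_mem_nhds (show (0 : ℝ) < 2 by norm_num))]
    with q h1 h2 h3 h4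
  exact ⟨h1.1, h1.2, h2.1, (h2.2.trans h3).le, h4.le⟩

namespace IsSmallBase

lemma le_half {q : ℝ} (h : IsSmallBase q) : q ≤ 1 / 2 := h.le_third.trans (by norm_num)

lemma three_le_zpow {q : ℝ} (h : IsSmallBase q) {l : ℤ} (hl : l ≤ -1) : 3 ≤ q ^ l := by
  have h1 : q ^ (-1 : ℤ) ≤ q ^ l :=
    zpow_le_zpow_right_of_le_one₀ h.pos (h.le_third.trans (by norm_num)) hl
  refine le_trans ?_ h1
  rw [zpow_neg_one, le_inv_comm₀ (by norm_num) h.pos]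
  exact h.le_third.trans (by norm_num)

lemma qBi_pos_and_le {q : ℝ} (h : IsSmallBase q) {l : ℤ} (hl : l ≤ 0) :
    0 < qBi q l ∧ qBi q l ≤ qBi q (l - 1) := by
  induction l, hl using Int.leInductionDown with
  | base => simpa using ⟨h.zero_pos, h.zero_le⟩
  | pred l hl ih =>
    have hp : 0 < qBi q (l - 1) := ih.1.trans_le ih.2
    refine ⟨hp, ?_⟩
    rw [qBi_recurrence h.pos h.le_half (l - 1), sub_add_cancel]
    nlinarith [h.three_le_zpow (show l - 1 ≤ -1 by omega)]

lemma qBi_pos {q : ℝ} (h : IsSmallBase q) {l : ℤ} (hl : l ≤ 0) : 0 < qBi q l :=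
  (h.qBi_pos_and_le hl).1

lemma two_mul_qBi_le {q : ℝ} (h : IsSmallBase q) {l : ℤ} (hl : l ≤ -1) :
    2 * qBi q l ≤ qBi q (l - 1) := by
  have h1 := h.qBi_pos_and_le (show l ≤ 0 by omega)
  have h2 := h.qBi_pos_and_le (show l + 1 ≤ 0 by omega)
  rw [add_sub_cancel_right] at h2
  rw [qBi_recurrence h.pos h.le_half l]
  nlinarith [h.three_le_zpow hl]

/-- The summand `(1 / 3)^k` compensates the factor lost in each step of the recurrence. -/
lemma airySum_one_ge {q : ℝ} (h : IsSmallBase q) (k : ℕ) :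
    qBi q (-1) * ((1 + (1 / 3) ^ k) / 2) ≤ airySum 1 q (-1 - k) := by
  have hb := h.qBi_pos (show (-1 : ℤ) ≤ 0 by norm_num)
  induction k with
  | zero => simp [qBi_eq_airySum h.pos, tri_neg_one]
  | succ k ih =>
    have hrec := airySum_sub_one h.pos h.le_half 1 (-1 - k)
    rw [show (-1 - (k : ℤ) - 1) = -1 - ((k + 1 : ℕ) : ℤ) by push_cast; ring] at hrec
    have hx0 : (0 : ℝ) < (1 / 3) ^ k := by positivity
    have hx1 : (1 / 3 : ℝ) ^ k ≤ 1 := pow_le_one₀ (by norm_num) (by norm_num)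
    have hq : q ^ (k + 1) ≤ (1 / 3) ^ k * (1 / 3) := by
      rw [← pow_succ]; exact pow_le_pow_left₀ h.pos.le h.le_third _
    -- the inequality `b(l + 1) ≤ b(l)` in terms of the normalised series
    have hdom : q ^ (-2 * (-1 - (k : ℤ)) - 1) * airySum 1 q (-1 - k + 1) ≤
        q ^ (k + 1) * airySum 1 q (-1 - k) := by
      have hd := (h.qBi_pos_and_le (show -1 - (k : ℤ) + 1 ≤ 0 by omega)).2
      rw [add_sub_cancel_right, qBi_eq_airySum h.pos, qBi_eq_airySum h.pos] at hd
      have ht : tri (-1 - (k : ℤ) + 1) = tri (-1 - k) - k :=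
        tri_eq_of (by have := two_mul_tri (-1 - (k : ℤ)); linarith)
      have hd2 := mul_le_mul_of_nonneg_left hd
        (zpow_nonneg h.pos.le (tri (-1 - (k : ℤ)) + (k + 1)))
      rw [← mul_assoc, ← mul_assoc, ← zpow_add₀ h.pos.ne', ← zpow_add₀ h.pos.ne', ht] at hd2
      refine le_of_eq_of_le ?_ (hd2.trans_eq ?_)
      · congr 2; ring
      · rw [← zpow_natCast]; congr 2; push_cast; ring
    have e : (1 / 3 : ℝ) ^ (k + 1) = (1 / 3) ^ k * (1 / 3) := pow_succ _ _
    rw [hrec, e]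
    set x := (1 / 3 : ℝ) ^ k
    set β := airySum 1 q (-1 - k)
    have hβ : 0 ≤ β := le_trans (by positivity) ih
    calc _ ≤ qBi q (-1) * ((1 + x) / 2) * (1 - x / 3) := by
          rw [mul_assoc]; gcongr; nlinarith
      _ ≤ β * (1 - x / 3) := by gcongr; linarith
      _ ≤ _ := by nlinarith

lemma tendsto_qAi_div_qBi {q : ℝ} (h : IsSmallBase q) :
    Tendsto (fun l => qAi q l / qBi q l) atBot (𝓝 0) := by
  have hb := h.qBi_pos (show (-1 : ℤ) ≤ 0 by norm_num)
  have ha := (tendsto_airySum_neg_one_atBot h.pos h.le_half).abs.mul_const (2 / qBi q (-1))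
  rw [abs_zero, zero_mul] at ha
  refine squeeze_zero_norm' ?_ ha
  filter_upwards [eventually_le_atBot (-1 : ℤ)] with l hl
  obtain ⟨k, rfl⟩ : ∃ k : ℕ, l = -1 - k := ⟨(-1 - l).toNat, by omega⟩
  have hβ : qBi q (-1) / 2 ≤ airySum 1 q (-1 - k) := by
    refine le_trans ?_ (h.airySum_one_ge k)
    have : (0 : ℝ) < (1 / 3) ^ k := by positivity
    nlinarith
  rw [qAi_eq_airySum h.pos, qBi_eq_airySum h.pos,
    mul_div_mul_left _ _ (zpow_ne_zero _ h.pos.ne'), Real.norm_eq_abs, abs_div,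
    abs_of_pos (show 0 < airySum 1 q (-1 - k) by linarith), div_eq_mul_inv]
  gcongr
  rw [inv_le_comm₀ (by linarith) (by positivity), inv_div]
  exact hβ

/-- The increments of `q`-Ai / `q`-Bi are given by the Casoratian, the ratio vanishes at `-∞`,
and the products of consecutive values of `q`-Bi grow at least geometrically. -/
lemma qAi_mul_qBi_bounds {q : ℝ} (h : IsSmallBase q) {l : ℤ} (hl : l ≤ -1) :
    qAi q 0 * qBi q (-1) - qAi q (-1) * qBi q 0 ≤ qAi q l * qBi q (l - 1) ∧
    qAi q l * qBi q (l - 1) ≤ (qAi q 0 * qBi q (-1) - qAi q (-1) * qBi q 0) *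
      (1 + 2 * (qBi q l / qBi q (l - 2))) := by
  set w := qAi q 0 * qBi q (-1) - qAi q (-1) * qBi q 0 with hw
  have hw0 : 0 ≤ w := h.casoratian_nonneg
  set u : ℤ → ℝ := fun l => qAi q l / qBi q l with hu
  have hstep {l : ℤ} (hl : l ≤ 0) : u l = u (l - 1) + w / (qBi q (l - 1) * qBi q l) := by
    have b1 := h.qBi_pos hl
    have b2 := h.qBi_pos (show l - 1 ≤ 0 by omega)
    have hc := casoratian_const h.pos h.le_half (l - 1)
    rw [sub_add_cancel] at hc
    simp only [hu]
    field_simp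
    linarith
  have hanti {v : ℤ → ℝ} (hv : Tendsto v atBot (𝓝 0)) (hm : ∀ l ≤ -1, v l ≤ v (l - 1))
      {l : ℤ} (hl : l ≤ -1) : v l ≤ 0 := by
    have hall (k : ℤ) (hk : k ≤ l) : v l ≤ v k := by
      induction k, hk using Int.leInductionDown with
      | base => exact le_rfl
      | pred k hk ih => exact ih.trans (hm k (hk.trans hl))
    refine ge_of_tendsto hv ?_
    filter_upwards [eventually_le_atBot l] with k hk using hall k hk
  have hlow {l : ℤ} (hl : l ≤ -1) : 0 ≤ u l := by
    have := hanti (v := fun l => -u l) (by simpa using h.tendsto_qAi_div_qBi.neg)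
      (fun l hl => by
        have b1 := h.qBi_pos (show l ≤ 0 by omega)
        have b2 := h.qBi_pos (show l - 1 ≤ 0 by omega)
        have := hstep (show l ≤ 0 by omega)
        have : 0 ≤ w / (qBi q (l - 1) * qBi q l) := by positivity
        linarith) hl
    linarith
  have hupp {l : ℤ} (hl : l ≤ -1) : u l ≤ 2 * (w / (qBi q (l - 1) * qBi q l)) := by
    set X : ℤ → ℝ := fun l => w / (qBi q (l - 1) * qBi q l) with hX
    have hlim : Tendsto X atBot (𝓝 0) := by
      have h1 := h.tendsto_qAi_div_qBi
      have h2 := h1.sub (h1.comp (tendsto_atBot_add_const_right atBot (-1 : ℤ) tendsto_id))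
      rw [sub_zero] at h2
      refine h2.congr' ?_
      filter_upwards [eventually_le_atBot (0 : ℤ)] with l hl
      have := hstep hl
      simp only [hu, hX, Function.comp_apply, id, ← sub_eq_add_neg] at this ⊢
      linarith
    have hgeom {l : ℤ} (hl : l ≤ -1) : 2 * X (l - 1) ≤ X l := by
      have b1 := h.qBi_pos (show l ≤ 0 by omega)
      have b2 := h.qBi_pos (show l - 1 ≤ 0 by omega)
      have b3 := h.qBi_pos (show l - 1 - 1 ≤ 0 by omega)
      have c1 := (h.qBi_pos_and_le (show l ≤ 0 by omega)).2
      have c2 := h.two_mul_qBi_le (show l - 1 ≤ -1 by omega)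
      simp only [hX]
      rw [mul_div_assoc', div_le_div_iff₀ (by positivity) (by positivity)]
      have h3 : w * qBi q (l - 1) * (2 * qBi q l) ≤ w * qBi q (l - 1) * qBi q (l - 1 - 1) := by
        gcongr; linarith
      linarith
    have hv : Tendsto (fun l => u l - 2 * X l) atBot (𝓝 0) := by
      simpa using h.tendsto_qAi_div_qBi.sub (hlim.const_mul 2)
    have := hanti hv (fun l hl => by
      have h1 := hstep (show l ≤ 0 by omega)
      have h2 := hgeom hl
      have h3 : X l = w / (qBi q (l - 1) * qBi q l) := rfl
      linarith) hl
    linarith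
  have b1 := h.qBi_pos (show l ≤ 0 by omega)
  have b2 := h.qBi_pos (show l - 1 ≤ 0 by omega)
  have b3 := h.qBi_pos (show l - 2 ≤ 0 by omega)
  have hal : qAi q l * qBi q (l - 1) = u l * (qBi q (l - 1) * qBi q l) := by
    simp only [hu]; field_simp
  have hw1 : w = w / (qBi q (l - 1) * qBi q l) * (qBi q (l - 1) * qBi q l) := by field_simp
  have hs := hstep (show l ≤ 0 by omega)
  have hp : 0 < qBi q (l - 1) * qBi q l := by positivity
  rw [hal]
  constructor
  · have := hlow (show l - 1 ≤ -1 by omega)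
    calc w = _ := hw1
      _ ≤ _ := by gcongr; linarith
  · have := hupp (show l - 1 ≤ -1 by omega)
    rw [show l - 1 - 1 = l - 2 by ring] at this
    calc _ ≤ (2 * (w / (qBi q (l - 2) * qBi q (l - 1))) + w / (qBi q (l - 1) * qBi q l)) *
          (qBi q (l - 1) * qBi q l) := by gcongr; linarith
      _ = _ := by field_simp; ring

end IsSmallBase

/-- The leading term of `q`-Bi at a negative integer is `2 q^{-l(l+1)/2}`. -/
lemma tendsto_qBi {l : ℤ} (hl : l ≤ -1) :
    Tendsto (fun q => qBi q l * q ^ tri l) (𝓝[>] 0) (𝓝 2) := by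
  have h := tendsto_airySum_nhdsGT_zero 1 l
  rw [if_pos (by omega), if_pos hl] at h
  norm_num at h
  refine h.congr' ?_
  filter_upwards [self_mem_nhdsWithin] with q hq
  rw [qBi_eq_airySum hq, mul_right_comm, ← zpow_add₀ (ne_of_gt hq)]
  simp

lemma tendsto_qAi_mul_qBi {l : ℤ} (hl : l ≤ -1) :
    Tendsto (fun q => qAi q l * qBi q (l - 1)) (𝓝[>] 0) (𝓝 2) := by
  have hratio : Tendsto (fun q => qBi q l / qBi q (l - 2)) (𝓝[>] 0) (𝓝 0) := by
    have h := ((tendsto_qBi hl).div (tendsto_qBi (show l - 2 ≤ -1 by omega)) two_ne_zero).mul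
      (tendsto_zpow_nhdsGT_zero (show 0 < 1 - 2 * l by omega))
    rw [mul_zero] at h
    refine h.congr' ?_
    filter_upwards [self_mem_nhdsWithin] with q hq
    have hq0 : q ≠ 0 := ne_of_gt hq
    have ht : tri (l - 2) = tri l + (1 - 2 * l) :=
      tri_eq_of (by have := two_mul_tri l; linarith)
    simp only [Pi.div_apply]
    rw [ht, zpow_add₀ hq0]
    have h1 : q ^ tri l ≠ 0 := zpow_ne_zero _ hq0
    have h2 : q ^ (1 - 2 * l) ≠ 0 := zpow_ne_zero _ hq0
    generalize q ^ tri l = x at *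
    generalize q ^ (1 - 2 * l) = y at *
    field_simp
  have hu := tendsto_casoratian.mul ((hratio.const_mul 2).const_add 1)
  rw [mul_zero, add_zero, mul_one] at hu
  refine tendsto_of_tendsto_of_tendsto_of_le_of_le' tendsto_casoratian hu ?_ ?_
  · filter_upwards [eventually_isSmallBase] with q hq using (hq.qAi_mul_qBi_bounds hl).1
  · filter_upwards [eventually_isSmallBase] with q hq using (hq.qAi_mul_qBi_bounds hl).2

/-- The leading term of `q`-Ai at a negative integer is `q^{l(l-1)/2}`. -/
lemma tendsto_qAi {l : ℤ} (hl : l ≤ -1) :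
    Tendsto (fun q => qAi q l * q ^ (-tri (l - 1))) (𝓝[>] 0) (𝓝 1) := by
  have h := (tendsto_qAi_mul_qBi hl).div (tendsto_qBi (show l - 1 ≤ -1 by omega)) two_ne_zero
  rw [div_self two_ne_zero] at h
  refine h.congr' ?_
  filter_upwards [eventually_isSmallBase] with q hq
  have := hq.qBi_pos (show l - 1 ≤ 0 by omega)
  have h1 : q ^ tri (l - 1) ≠ 0 := zpow_ne_zero _ hq.pos.ne'
  simp only [Pi.div_apply, zpow_neg]
  field_simp

/-! ### Minimal terms of the expanded determinant -/

/-- The order in `q` of the entry in column `j` of the Leibniz term of `σ`, when the columns in `S`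
carry `q`-Bi and the others `q`-Ai. -/
def entryVal {N : ℕ} (m : ℤ) (σ : Equiv.Perm (Fin N)) (S : Finset (Fin N)) (j : Fin N) : ℤ :=
  if j ∈ S then -tri (m - ((σ j : ℕ) : ℤ) + 2 * ((j : ℕ) : ℤ))
  else tri (m - ((σ j : ℕ) : ℤ) + 2 * ((j : ℕ) : ℤ) - 1)

/-- The order in `q` of the Leibniz term of `σ` with `q`-Bi in the columns `S`. -/
def termVal {N : ℕ} (m : ℤ) (σ : Equiv.Perm (Fin N)) (S : Finset (Fin N)) : ℤ :=
  ∑ j, entryVal m σ S j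

lemma sum_lt_sum_of_pair {N : ℕ} {f g : Fin N → ℤ} {a b : Fin N} (hab : a ≠ b)
    (h : ∀ x, x ≠ a → x ≠ b → f x = g x) (hlt : f a + f b < g a + g b) :
    ∑ x, f x < ∑ x, g x := by
  rw [← sub_neg, ← Finset.sum_sub_distrib,
    Fintype.sum_eq_add a b hab fun x hx => sub_eq_zero.2 (h x hx.1 hx.2)]
  linarith

/-- Exchanging the rows of two columns. -/
lemma termVal_row_swap_lt {N : ℕ} {m : ℤ} {σ : Equiv.Perm (Fin N)} {S : Finset (Fin N)}
    {a b : Fin N} (hab : a ≠ b)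
    (hlt : (if a ∈ S then -tri (m - ((σ b : ℕ) : ℤ) + 2 * ((a : ℕ) : ℤ))
        else tri (m - ((σ b : ℕ) : ℤ) + 2 * ((a : ℕ) : ℤ) - 1)) +
      (if b ∈ S then -tri (m - ((σ a : ℕ) : ℤ) + 2 * ((b : ℕ) : ℤ))
        else tri (m - ((σ a : ℕ) : ℤ) + 2 * ((b : ℕ) : ℤ) - 1)) <
      entryVal m σ S a + entryVal m σ S b) :
    termVal m (σ * Equiv.swap a b) S < termVal m σ S := by
  refine sum_lt_sum_of_pair hab (fun x ha hb => ?_) ?_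
  · simp [entryVal, Equiv.swap_apply_of_ne_of_ne ha hb]
  · simpa [entryVal] using hlt

/-- Exchanging two columns of different kinds, together with their kinds. -/
lemma termVal_column_swap_lt {N : ℕ} {m : ℤ} {σ : Equiv.Perm (Fin N)} {S : Finset (Fin N)}
    {a b : Fin N} (ha : a ∈ S) (hb : b ∉ S)
    (hlt : tri (m - ((σ b : ℕ) : ℤ) + 2 * ((a : ℕ) : ℤ) - 1) +
      -tri (m - ((σ a : ℕ) : ℤ) + 2 * ((b : ℕ) : ℤ)) <
      -tri (m - ((σ a : ℕ) : ℤ) + 2 * ((a : ℕ) : ℤ)) +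
      tri (m - ((σ b : ℕ) : ℤ) + 2 * ((b : ℕ) : ℤ) - 1)) :
    termVal m (σ * Equiv.swap a b) (S.map (Equiv.swap a b).toEmbedding) < termVal m σ S := by
  have hab : a ≠ b := fun h => hb (h ▸ ha)
  refine sum_lt_sum_of_pair hab (fun x hxa hxb => ?_) ?_
  · simp [entryVal, Finset.mem_map_equiv, Equiv.swap_apply_of_ne_of_ne hxa hxb]
  · simpa [entryVal, Finset.mem_map_equiv, ha, hb] using hlt

/-- `(σ, S)` has the least order among all terms with the same number of `q`-Bi factors. -/
def IsMinimalTerm {N : ℕ} (m : ℤ) (σ : Equiv.Perm (Fin N)) (S : Finset (Fin N)) : Prop :=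
  ∀ (σ' : Equiv.Perm (Fin N)) (S' : Finset (Fin N)), S'.card = S.card →
    termVal m σ S ≤ termVal m σ' S'

namespace IsMinimalTerm

variable {N : ℕ} {m : ℤ} {σ : Equiv.Perm (Fin N)} {S : Finset (Fin N)}

lemma lt_of_mem_of_mem (h : IsMinimalTerm m σ S) {a b : Fin N} (hab : a < b) (ha : a ∈ S)
    (hb : b ∈ S) : σ b < σ a := by
  by_contra hcon
  have hlt : σ a < σ b := lt_of_le_of_ne (not_lt.1 hcon) (σ.injective.ne hab.ne)
  refine (termVal_row_swap_lt hab.ne ?_).not_ge (h _ S rfl)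
  simp only [entryVal, ha, hb, if_true]
  have h1 : ((a : ℕ) : ℤ) < (b : ℕ) := by exact_mod_cast hab
  have h2 : ((σ a : ℕ) : ℤ) < (σ b : ℕ) := by exact_mod_cast hlt
  generalize ((a : ℕ) : ℤ) = x, ((b : ℕ) : ℤ) = y, ((σ a : ℕ) : ℤ) = i, ((σ b : ℕ) : ℤ) = j at *
  have t1 := two_mul_tri (m - j + 2 * x)
  have t2 := two_mul_tri (m - i + 2 * y)
  have t3 := two_mul_tri (m - i + 2 * x)
  have t4 := two_mul_tri (m - j + 2 * y)
  linarith [mul_pos (sub_pos.2 h1) (sub_pos.2 h2)]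

lemma lt_of_notMem_of_notMem (h : IsMinimalTerm m σ S) {a b : Fin N} (hab : a < b) (ha : a ∉ S)
    (hb : b ∉ S) : σ a < σ b := by
  by_contra hcon
  have hlt : σ b < σ a := lt_of_le_of_ne (not_lt.1 hcon) (σ.injective.ne hab.ne')
  refine (termVal_row_swap_lt hab.ne ?_).not_ge (h _ S rfl)
  simp only [entryVal, ha, hb, if_false]
  have h1 : ((a : ℕ) : ℤ) < (b : ℕ) := by exact_mod_cast hab
  have h2 : ((σ b : ℕ) : ℤ) < (σ a : ℕ) := by exact_mod_cast hlt
  generalize ((a : ℕ) : ℤ) = x, ((b : ℕ) : ℤ) = y, ((σ a : ℕ) : ℤ) = i, ((σ b : ℕ) : ℤ) = j at *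
  have t1 := two_mul_tri (m - j + 2 * x - 1)
  have t2 := two_mul_tri (m - i + 2 * y - 1)
  have t3 := two_mul_tri (m - i + 2 * x - 1)
  have t4 := two_mul_tri (m - j + 2 * y - 1)
  linarith [mul_pos (sub_pos.2 h1) (sub_pos.2 h2)]

/-- The bound on `m` makes the order of `q`-Bi decrease, and that of `q`-Ai increase, in the row. -/
lemma lt_of_mem_of_notMem (hm : m ≤ -2 * (N : ℤ) + 1) (h : IsMinimalTerm m σ S) {a b : Fin N}
    (ha : a ∈ S) (hb : b ∉ S) : σ b < σ a := by
  have hab : a ≠ b := fun h => hb (h ▸ ha)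
  by_contra hcon
  have hlt : σ a < σ b := lt_of_le_of_ne (not_lt.1 hcon) (σ.injective.ne hab)
  refine (termVal_row_swap_lt hab ?_).not_ge (h _ S rfl)
  simp only [entryVal, ha, hb, if_true, if_false]
  have h1 : ((a : ℕ) : ℤ) < N := by exact_mod_cast a.2
  have h2 : ((b : ℕ) : ℤ) < N := by exact_mod_cast b.2
  have h3 : ((σ a : ℕ) : ℤ) < (σ b : ℕ) := by exact_mod_cast hlt
  have h4 : (0 : ℤ) ≤ (σ a : ℕ) := by positivity
  generalize ((a : ℕ) : ℤ) = x, ((b : ℕ) : ℤ) = y, ((σ a : ℕ) : ℤ) = i, ((σ b : ℕ) : ℤ) = j at *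
  have t1 := two_mul_tri (m - j + 2 * x)
  have t2 := two_mul_tri (m - i + 2 * y - 1)
  have t3 := two_mul_tri (m - i + 2 * x)
  have t4 := two_mul_tri (m - j + 2 * y - 1)
  have h5 : 0 < -2 * m + i + j - 2 * x - 2 * y := by linarith
  linarith [mul_pos (sub_pos.2 h3) h5]

lemma column_lt (hm : m ≤ -2 * (N : ℤ) + 1) (h : IsMinimalTerm m σ S) {a b : Fin N}
    (ha : a ∈ S) (hb : b ∉ S) : a < b := by
  have hab : a ≠ b := fun h => hb (h ▸ ha)
  by_contra hcon
  have hlt : b < a := lt_of_le_of_ne (not_lt.1 hcon) hab.symm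
  refine (termVal_column_swap_lt ha hb ?_).not_ge (h _ _ (Finset.card_map _))
  have h1 : ((a : ℕ) : ℤ) < N := by exact_mod_cast a.2
  have h2 : ((b : ℕ) : ℤ) < (a : ℕ) := by exact_mod_cast hlt
  have h3 : (0 : ℤ) ≤ (σ b : ℕ) := by positivity
  have h4 : (0 : ℤ) ≤ (σ a : ℕ) := by positivity
  generalize ((a : ℕ) : ℤ) = x, ((b : ℕ) : ℤ) = y, ((σ a : ℕ) : ℤ) = i, ((σ b : ℕ) : ℤ) = j at *
  have t1 := two_mul_tri (m - j + 2 * x - 1)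
  have t2 := two_mul_tri (m - i + 2 * y)
  have t3 := two_mul_tri (m - i + 2 * x)
  have t4 := two_mul_tri (m - j + 2 * y - 1)
  have h5 : 0 < -4 * m + 2 * i + 2 * j - 4 * x - 4 * y := by linarith
  linarith [mul_pos (sub_pos.2 h2) h5]

lemma mem_iff (hm : m ≤ -2 * (N : ℤ) + 1) (h : IsMinimalTerm m σ S) (j : Fin N) :
    j ∈ S ↔ (j : ℕ) < S.card := by
  constructor
  · intro hj
    have hsub : Finset.Iic j ⊆ S := fun b hb => by
      by_contra hbS
      exact (h.column_lt hm hj hbS).not_ge (Finset.mem_Iic.1 hb)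
    have := Finset.card_le_card hsub
    rw [Fin.card_Iic] at this
    omega
  · intro hj
    by_contra hjS
    have hsub : S ⊆ Finset.Iio j := fun b hb => Finset.mem_Iio.2 (h.column_lt hm hb hjS)
    have := Finset.card_le_card hsub
    rw [Fin.card_Iio] at this
    omega

lemma apply_lt_apply_iff (hm : m ≤ -2 * (N : ℤ) + 1) (h : IsMinimalTerm m σ S) {a b : Fin N}
    (hab : a < b) : σ a < σ b ↔ S.card ≤ (a : ℕ) := by
  by_cases ha : a ∈ S
  · have h1 : ¬ S.card ≤ (a : ℕ) := not_le.2 ((h.mem_iff hm a).1 ha)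
    have h2 : σ b < σ a := by
      by_cases hb : b ∈ S
      · exact h.lt_of_mem_of_mem hab ha hb
      · exact h.lt_of_mem_of_notMem hm ha hb
    exact iff_of_false h2.not_gt h1
  · have h1 : S.card ≤ (a : ℕ) := not_lt.1 fun hlt => ha ((h.mem_iff hm a).2 hlt)
    have hb : b ∉ S := fun hb => ha ((h.mem_iff hm a).2
      (lt_trans (show (a : ℕ) < b from hab) ((h.mem_iff hm b).1 hb)))
    exact iff_of_true (h.lt_of_notMem_of_notMem hab ha hb) h1

end IsMinimalTerm

lemma perm_eq_of_lt_iff_lt {N : ℕ} {σ τ : Equiv.Perm (Fin N)}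
    (h : ∀ a b, a < b → (σ a < σ b ↔ τ a < τ b)) : σ = τ := by
  have hmono : StrictMono fun x => τ (σ.symm x) := by
    intro x y hxy
    rcases lt_trichotomy (σ.symm x) (σ.symm y) with hlt | heq | hgt
    · exact (h _ _ hlt).1 (by simpa using hxy)
    · exact absurd (σ.symm.injective heq) hxy.ne
    · refine lt_of_le_of_ne (not_lt.1 fun hcon => ?_) (τ.injective.ne hgt.ne')
      have := (h _ _ hgt).2 hcon
      simp only [Equiv.apply_symm_apply] at this
      exact this.not_gt hxy
  have hid : (fun x => τ (σ.symm x)) = id := by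
    refine (hmono.range_inj strictMono_id).1 ?_
    rw [Set.range_id]
    exact (τ.surjective.comp σ.symm.surjective).range_eq
  ext1 j
  simpa using (congrFun hid (σ j)).symm

/-- The permutation of the minimal term with `k` factors `q`-Bi: it reverses the first `k` columns
into the last `k` rows and keeps the order of the other columns. -/
lemma exists_extremalPerm (N k : ℕ) :
    ∃ τ : Equiv.Perm (Fin N), ∀ j : Fin N,
      (τ j : ℕ) = if (j : ℕ) < k then N - 1 - j else j - k := by
  have hlt (j : Fin N) : (if (j : ℕ) < k then N - 1 - j else j - k) < N := by
    have := j.2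
    split_ifs <;> omega
  have hinj : Function.Injective fun j : Fin N =>
      (⟨if (j : ℕ) < k then N - 1 - j else j - k, hlt j⟩ : Fin N) := by
    intro a b hab
    have h1 := a.2
    have h2 := b.2
    simp only [Fin.mk.injEq] at hab
    ext
    split_ifs at hab <;> omega
  exact ⟨Equiv.ofBijective _ (Finite.injective_iff_bijective.1 hinj), fun j => rfl⟩

/-- The permutation `j ↦ N - 1 - j` for `j < k`, `j ↦ j - k` for `k ≤ j`. -/
def extremalPerm (N k : ℕ) : Equiv.Perm (Fin N) := (exists_extremalPerm N k).choose

lemma extremalPerm_apply {N k : ℕ} (j : Fin N) :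
    (extremalPerm N k j : ℕ) = if (j : ℕ) < k then N - 1 - j else j - k :=
  (exists_extremalPerm N k).choose_spec j

lemma extremalPerm_lt_iff {N k : ℕ} {a b : Fin N} (hab : a < b) :
    extremalPerm N k a < extremalPerm N k b ↔ k ≤ (a : ℕ) := by
  have h1 := b.2
  have h2 : (a : ℕ) < b := hab
  rw [Fin.lt_def, extremalPerm_apply, extremalPerm_apply]
  split_ifs <;> omega

/-- The first `k` columns. -/
def extremalSet (N k : ℕ) : Finset (Fin N) := Finset.univ.filter fun j => (j : ℕ) < k

lemma IsMinimalTerm.eq_extremal {N : ℕ} {m : ℤ} {σ : Equiv.Perm (Fin N)} {S : Finset (Fin N)}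
    (hm : m ≤ -2 * (N : ℤ) + 1) (h : IsMinimalTerm m σ S) :
    σ = extremalPerm N S.card ∧ S = extremalSet N S.card := by
  have hk : S.card ≤ N := by simpa using Finset.card_le_univ S
  refine ⟨perm_eq_of_lt_iff_lt fun a b hab => ?_, ?_⟩
  · rw [h.apply_lt_apply_iff hm hab, extremalPerm_lt_iff hab]
  · ext j
    simp [extremalSet, h.mem_iff hm j]

lemma card_extremalSet {N k : ℕ} (hk : k ≤ N) : (extremalSet N k).card = k := by
  rw [extremalSet, Fin.card_filter_val_lt]
  omega

/-- The extremal term is the only minimiser of the order in `q`, so it is not cancelled. -/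
lemma termVal_extremal_lt {N k : ℕ} {m : ℤ} (hm : m ≤ -2 * (N : ℤ) + 1)
    {σ : Equiv.Perm (Fin N)} {S : Finset (Fin N)} (hS : S.card = k)
    (hne : ¬ (σ = extremalPerm N k ∧ S = extremalSet N k)) :
    termVal m (extremalPerm N k) (extremalSet N k) < termVal m σ S := by
  classical
  obtain ⟨⟨σ', S'⟩, hmem, hmin⟩ := Finset.exists_min_image
    (Finset.univ ×ˢ Finset.powersetCard k (Finset.univ : Finset (Fin N)))
    (fun p : Equiv.Perm (Fin N) × Finset (Fin N) => termVal m p.1 p.2) ⟨(σ, S), by simp [hS]⟩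
  simp only [Finset.mem_product, Finset.mem_univ, Finset.mem_powersetCard_univ, true_and] at hmem
  have hle (σ'' : Equiv.Perm (Fin N)) (S'' : Finset (Fin N)) (hc : S''.card = k) :
      termVal m σ' S' ≤ termVal m σ'' S'' := hmin (σ'', S'') (by simp [hc])
  have hM : IsMinimalTerm m σ' S' := fun σ'' S'' hc => hle σ'' S'' (hc.trans hmem)
  have he := hM.eq_extremal hm
  rw [hmem] at he
  rw [← he.1, ← he.2]
  refine lt_of_le_of_ne (hle σ S hS) fun heq => hne ?_
  have hM' : IsMinimalTerm m σ S := fun σ'' S'' hc => heq ▸ hle σ'' S'' (hc.trans hS)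
  have he' := hM'.eq_extremal hm
  rwa [hS] at he'

lemma tri_cast (l : ℤ) : (tri l : ℝ) = l * (l + 1) / 2 := by
  have := two_mul_tri l
  have h : 2 * (tri l : ℝ) = l * (l + 1) := by exact_mod_cast this
  linarith

lemma sum_range_biOrders (x : ℝ) (k : ℕ) :
    ∑ j ∈ Finset.range k, -((x + 3 * j) * (x + 3 * j + 1) / 2) =
      -(k * (x ^ 2 + x) + (6 * x + 3) * (k * (k - 1) / 2)
        + 9 * ((k - 1) * k * (2 * k - 1) / 6)) / 2 := by
  induction k with
  | zero => simp
  | succ k ih => rw [Finset.sum_range_succ, ih]; push_cast; ring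

lemma sum_range_aiOrders (y : ℝ) (n : ℕ) :
    ∑ i ∈ Finset.range n, (y + i - 1) * (y + i - 1 + 1) / 2 =
      (n * (y ^ 2 - y) + (2 * y - 1) * (n * (n - 1) / 2) + (n - 1) * n * (2 * n - 1) / 6) / 2 := by
  induction n with
  | zero => simp
  | succ k ih => rw [Finset.sum_range_succ, ih]; push_cast; ring

/-- The order of the extremal term is the coefficient of `Q` in `GTerm`. -/
lemma termVal_extremal {N k : ℕ} (hk : k ≤ N) (A B Q : ℝ) (m : ℤ) :
    ((N : ℝ) - k) * A + k * B + termVal m (extremalPerm N k) (extremalSet N k) * Q =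
      GTerm A B Q N k m := by
  obtain ⟨n, rfl⟩ := Nat.exists_eq_add_of_le hk
  have hval : (termVal m (extremalPerm (k + n) k) (extremalSet (k + n) k) : ℝ) =
      ∑ j ∈ Finset.range (k + n),
        if j < k then -(((m - (k + n : ℕ) + 1 : ℝ) + 3 * j) *
          ((m - (k + n : ℕ) + 1 : ℝ) + 3 * j + 1) / 2)
        else ((m + k + j : ℝ) - 1) * ((m + k + j : ℝ) - 1 + 1) / 2 := by
    rw [termVal, Int.cast_sum, ← Fin.sum_univ_eq_sum_range (fun j : ℕ =>
      if j < k then -(((m - (k + n : ℕ) + 1 : ℝ) + 3 * j) *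
          ((m - (k + n : ℕ) + 1 : ℝ) + 3 * j + 1) / 2)
        else ((m + k + j : ℝ) - 1) * ((m + k + j : ℝ) - 1 + 1) / 2)]
    refine Finset.sum_congr rfl fun j _ => ?_
    have hj := j.2
    simp only [entryVal, extremalPerm_apply, extremalSet, Finset.mem_filter, Finset.mem_univ,
      true_and]
    by_cases h : (j : ℕ) < k
    · simp only [h, if_true]
      rw [show k + n - 1 - (j : ℕ) = k + n - (1 + j) by omega, Nat.cast_sub (by omega)]
      push_cast [tri_cast]
      ring
    · simp only [h, if_false]
      rw [Nat.cast_sub (by omega)]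
      push_cast [tri_cast]
      ring
  rw [hval, Finset.sum_range_add, Finset.sum_congr rfl (g := fun j : ℕ =>
    -(((m - (k + n : ℕ) + 1 : ℝ) + 3 * j) * ((m - (k + n : ℕ) + 1 : ℝ) + 3 * j + 1) / 2))
    (fun j hj => if_pos (Finset.mem_range.1 hj)), sum_range_biOrders,
    Finset.sum_congr rfl (g := fun i : ℕ =>
    ((m + 2 * k : ℝ) + i - 1) * ((m + 2 * k : ℝ) + i - 1 + 1) / 2)
    (fun j hj => by rw [if_neg (by omega)]; push_cast; ring), sum_range_aiOrders, GTerm]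
  push_cast
  ring

lemma prod_range_neg_one_pow {N k : ℕ} (hk : k ≤ N) :
    ∏ i ∈ Finset.range k, (-1 : ℤˣ) ^ (N - 1 - i) = (-1) ^ (N * k - k * (k + 1) / 2) := by
  induction k with
  | zero => simp
  | succ k ih =>
    rw [Finset.prod_range_succ, ih (by omega), ← pow_add]
    congr 1
    have h1 : (k + 1) * (k + 1 + 1) / 2 = k * (k + 1) / 2 + (k + 1) := by
      rw [← Nat.add_mul_div_right _ _ (by norm_num)]; congr 1; ring
    have h2 : k * (k + 1) / 2 ≤ N * k := by
      refine Nat.div_le_of_le_mul ?_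
      nlinarith
    rw [h1, show N * (k + 1) = N * k + N from Nat.mul_succ N k]
    generalize k * (k + 1) / 2 = t at h2 ⊢
    omega

lemma sign_extremalPerm {N k : ℕ} (hk : k ≤ N) :
    Equiv.Perm.sign (extremalPerm N k) = (-1) ^ (N * k - k * (k + 1) / 2) := by
  have hrow (i : Fin N) : (∏ j ∈ Finset.Ioi i,
      (if extremalPerm N k i < extremalPerm N k j then 1 else -1 : ℤˣ)) =
      if (i : ℕ) < k then (-1) ^ (N - 1 - (i : ℕ)) else 1 := by
    rw [Finset.prod_congr rfl (g := fun _ => if (i : ℕ) < k then (-1 : ℤˣ) else 1),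
      Finset.prod_const, Fin.card_Ioi]
    · split_ifs <;> simp
    · intro j hj
      simp only [extremalPerm_lt_iff (Finset.mem_Ioi.1 hj)]
      split_ifs <;> first | rfl | omega
  rw [Equiv.Perm.sign_eq_prod_prod_Ioi, Finset.prod_congr rfl fun i _ => hrow i,
    Fin.prod_univ_eq_prod_range (fun i => if i < k then (-1 : ℤˣ) ^ (N - 1 - i) else 1),
    ← prod_range_neg_one_pow hk]
  obtain ⟨n, rfl⟩ := Nat.exists_eq_add_of_le hk
  rw [Finset.prod_range_add, Finset.prod_congr rfl fun i hi => if_pos (Finset.mem_range.1 hi)]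
  simp

/-! ### Leading terms of functions of `ε` -/

/-- `x(ε) = e^{E/ε} (C + o(1))` as `ε → +0`; the coefficient `C` may vanish. -/
def HasLeadingTerm (x : ℝ → ℝ) (C E : ℝ) : Prop :=
  Tendsto (fun ε => x ε * Real.exp (-(E / ε))) (𝓝[>] 0) (𝓝 C)

namespace HasLeadingTerm

variable {x y : ℝ → ℝ} {C D E F : ℝ}

lemma const (C : ℝ) : HasLeadingTerm (fun _ => C) C 0 := by
  simp [HasLeadingTerm]

lemma mul (hx : HasLeadingTerm x C E) (hy : HasLeadingTerm y D F) :
    HasLeadingTerm (fun ε => x ε * y ε) (C * D) (E + F) := by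
  refine (Tendsto.mul hx hy).congr fun ε => ?_
  rw [add_div, neg_add, Real.exp_add]
  ring

lemma prod {ι : Type*} {s : Finset ι} {x : ι → ℝ → ℝ} {C E : ι → ℝ}
    (h : ∀ i ∈ s, HasLeadingTerm (x i) (C i) (E i)) :
    HasLeadingTerm (fun ε => ∏ i ∈ s, x i ε) (∏ i ∈ s, C i) (∑ i ∈ s, E i) := by
  classical
  induction s using Finset.induction_on with
  | empty => simpa using const 1
  | insert a s ha ih =>
    simp only [Finset.prod_insert ha, Finset.sum_insert ha]
    exact (h a (by simp)).mul (ih fun i hi => h i (by simp [hi]))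

lemma sum {ι : Type*} {s : Finset ι} {x : ι → ℝ → ℝ} {C : ι → ℝ}
    (h : ∀ i ∈ s, HasLeadingTerm (x i) (C i) E) :
    HasLeadingTerm (fun ε => ∑ i ∈ s, x i ε) (∑ i ∈ s, C i) E := by
  refine (tendsto_finsetSum s h).congr fun ε => ?_
  rw [Finset.sum_mul]

lemma zero_of_lt (hx : HasLeadingTerm x C E) (hlt : E < F) : HasLeadingTerm x 0 F := by
  have he : Tendsto (fun ε : ℝ => Real.exp (-((F - E) / ε))) (𝓝[>] 0) (𝓝 0) := by
    refine Real.tendsto_exp_atBot.comp (tendsto_neg_atTop_atBot.comp ?_)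
    exact (tendsto_inv_nhdsGT_zero.const_mul_atTop (sub_pos.2 hlt)).congr fun ε =>
      (div_eq_mul_inv _ _).symm
  have h := Tendsto.mul hx he
  rw [mul_zero] at h
  refine h.congr fun ε => ?_
  rw [mul_assoc, ← Real.exp_add]
  congr 2
  ring

lemma of_le (hx : HasLeadingTerm x C E) (hle : E ≤ F) :
    HasLeadingTerm x (if E = F then C else 0) F := by
  split_ifs with h
  · exact h ▸ hx
  · exact hx.zero_of_lt (lt_of_le_of_ne hle h)

end HasLeadingTerm

lemma tendsto_exp_div {Q : ℝ} (hQ : Q < 0) :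
    Tendsto (fun ε : ℝ => Real.exp (Q / ε)) (𝓝[>] 0) (𝓝[>] 0) := by
  refine tendsto_nhdsWithin_of_tendsto_nhds_of_eventually_within _ ?_
    (Eventually.of_forall fun ε => Real.exp_pos _)
  refine Real.tendsto_exp_atBot.comp ?_
  exact (tendsto_inv_nhdsGT_zero.const_mul_atTop_of_neg hQ).congr fun ε =>
    (div_eq_mul_inv _ _).symm

lemma exp_zpow (x : ℝ) (n : ℤ) : Real.exp x ^ n = Real.exp (n * x) := by
  rw [← Real.rpow_intCast, ← Real.exp_mul, mul_comm]

lemma hasLeadingTerm_qBi {Q : ℝ} (hQ : Q < 0) (B b : ℝ) {l : ℤ} (hl : l ≤ -1) :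
    HasLeadingTerm (fun ε => b * Real.exp (B / ε) * qBi (Real.exp (Q / ε)) l) (b * 2)
      (B + ((-tri l : ℤ) : ℝ) * Q) := by
  refine (((tendsto_qBi hl).comp (tendsto_exp_div hQ)).const_mul b).congr fun ε => ?_
  simp only [Function.comp_apply]
  rw [exp_zpow, mul_right_comm b, mul_assoc (b * _), ← Real.exp_add, mul_assoc]
  congr 3
  push_cast
  ring

lemma hasLeadingTerm_qAi {Q : ℝ} (hQ : Q < 0) (A a : ℝ) {l : ℤ} (hl : l ≤ -1) :
    HasLeadingTerm (fun ε => a * Real.exp (A / ε) * qAi (Real.exp (Q / ε)) l) a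
      (A + (tri (l - 1) : ℝ) * Q) := by
  have h := ((tendsto_qAi hl).comp (tendsto_exp_div hQ)).const_mul a
  rw [mul_one] at h
  refine h.congr fun ε => ?_
  simp only [Function.comp_apply]
  rw [exp_zpow, mul_right_comm a, mul_assoc (a * _), ← Real.exp_add, mul_assoc]
  congr 3
  push_cast
  ring

/-! ### Expansion of the determinant by the number of `q`-Bi factors -/

/-- The product of the entries of the Leibniz term of `σ` with `q`-Bi in the columns `S`. -/
def mixedTerm (A B Q : ℝ) (α β : ℤˣ) {N : ℕ} (m : ℤ) (σ : Equiv.Perm (Fin N))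
    (S : Finset (Fin N)) (ε : ℝ) : ℝ :=
  ∏ j, if j ∈ S
    then ((β : ℤ) : ℝ) * Real.exp (B / ε) *
      qBi (Real.exp (Q / ε)) (m - ((σ j : ℕ) : ℤ) + 2 * ((j : ℕ) : ℤ))
    else ((α : ℤ) : ℝ) * Real.exp (A / ε) *
      qAi (Real.exp (Q / ε)) (m - ((σ j : ℕ) : ℤ) + 2 * ((j : ℕ) : ℤ))

/-- The part of the determinant that is homogeneous of degree `k` in `c₂`. -/
def homogeneousPart (A B Q : ℝ) (α β : ℤˣ) (N k : ℕ) (m : ℤ) (ε : ℝ) : ℝ :=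
  ∑ p ∈ Finset.powersetCard k (Finset.univ : Finset (Fin N)) ×ˢ
      (Finset.univ : Finset (Equiv.Perm (Fin N))),
    ((Equiv.Perm.sign p.2 : ℤ) : ℝ) * mixedTerm A B Q α β m p.2 p.1 ε

lemma gEps_eq_sum (A B Q : ℝ) (α β : ℤˣ) (N : ℕ) (m : ℤ) (ε : ℝ) :
    gEps A B Q α β N m ε =
      ∑ k ∈ Finset.range (N + 1), homogeneousPart A B Q α β N k m ε := by
  classical
  have hprod (σ : Equiv.Perm (Fin N)) :
      ∏ j, seed (Real.exp (Q / ε)) (((α : ℤ) : ℝ) * Real.exp (A / ε))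
        (((β : ℤ) : ℝ) * Real.exp (B / ε)) (m - ((σ j : ℕ) : ℤ) + 2 * ((j : ℕ) : ℤ)) =
      ∑ S ∈ (Finset.univ : Finset (Fin N)).powerset, mixedTerm A B Q α β m σ S ε := by
    simp only [seed]
    rw [Finset.prod_congr rfl fun j _ => add_comm _ _, Finset.prod_add]
    refine Finset.sum_congr rfl fun S _ => ?_
    rw [mixedTerm, Finset.prod_ite]
    congr 2 <;> ext <;> simp
  have hdet : gEps A B Q α β N m ε = ∑ σ : Equiv.Perm (Fin N),
      ∑ S ∈ (Finset.univ : Finset (Fin N)).powerset,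
        ((Equiv.Perm.sign σ : ℤ) : ℝ) * mixedTerm A B Q α β m σ S ε := by
    simp only [gEps, gDet, Matrix.det_apply', Matrix.of_apply, hprod, Finset.mul_sum]
  rw [hdet, Finset.sum_comm, Finset.sum_powerset, Finset.card_univ, Fintype.card_fin]
  refine Finset.sum_congr rfl fun k _ => ?_
  rw [homogeneousPart, Finset.sum_product]

lemma hasLeadingTerm_mixedTerm {Q : ℝ} (hQ : Q < 0) (A B : ℝ) (α β : ℤˣ) {N : ℕ} {m : ℤ}
    (hm : m ≤ -2 * (N : ℤ) + 1) (σ : Equiv.Perm (Fin N)) (S : Finset (Fin N)) :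
    HasLeadingTerm (mixedTerm A B Q α β m σ S)
      ((((α ^ (N - S.card) * β ^ S.card : ℤˣ) : ℤ) : ℝ) * 2 ^ S.card)
      (((N : ℝ) - S.card) * A + S.card * B + termVal m σ S * Q) := by
  classical
  have hk : S.card ≤ N := by simpa using Finset.card_le_univ S
  have h := HasLeadingTerm.prod (s := (Finset.univ : Finset (Fin N)))
    (x := fun j ε => if j ∈ S
      then ((β : ℤ) : ℝ) * Real.exp (B / ε) *
        qBi (Real.exp (Q / ε)) (m - ((σ j : ℕ) : ℤ) + 2 * ((j : ℕ) : ℤ))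
      else ((α : ℤ) : ℝ) * Real.exp (A / ε) *
        qAi (Real.exp (Q / ε)) (m - ((σ j : ℕ) : ℤ) + 2 * ((j : ℕ) : ℤ)))
    (C := fun j => if j ∈ S then ((β : ℤ) : ℝ) * 2 else ((α : ℤ) : ℝ))
    (E := fun j => (if j ∈ S then B else A) + (entryVal m σ S j : ℝ) * Q) (fun j _ => by
      have hj := j.2
      have hl : m - ((σ j : ℕ) : ℤ) + 2 * ((j : ℕ) : ℤ) ≤ -1 := by omega
      by_cases hS : j ∈ S
      · simp only [entryVal, hS, if_true]
        exact hasLeadingTerm_qBi hQ B _ hl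
      · simp only [entryVal, hS, if_false]
        exact hasLeadingTerm_qAi hQ A _ hl)
  have hcard : (Finset.univ.filter fun j => j ∉ S).card = N - S.card := by
    rw [Finset.filter_not, Finset.card_sdiff_of_subset (by simp)]
    simp
  have hfilter : (Finset.univ.filter fun j => j ∈ S) = S := by ext; simp
  convert! h using 1
  · rw [Finset.prod_ite, Finset.prod_const, Finset.prod_const, hcard, hfilter]
    push_cast
    ring
  · rw [Finset.sum_add_distrib, ← Finset.sum_mul, Finset.sum_ite, Finset.sum_const,
      Finset.sum_const, hcard, hfilter, termVal]
    rw [nsmul_eq_mul, nsmul_eq_mul, Nat.cast_sub hk]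
    push_cast
    ring

lemma hasLeadingTerm_homogeneousPart {Q : ℝ} (hQ : Q < 0) (A B : ℝ) (α β : ℤˣ) {N k : ℕ}
    (hk : k ≤ N) {m : ℤ} (hm : m ≤ -2 * (N : ℤ) + 1) :
    HasLeadingTerm (homogeneousPart A B Q α β N k m)
      (((gammaTerm α β N k : ℤ) : ℝ) * 2 ^ k) (GTerm A B Q N k m) := by
  classical
  set C : Finset (Fin N) × Equiv.Perm (Fin N) → ℝ := fun p =>
    if p = (extremalSet N k, extremalPerm N k) then ((gammaTerm α β N k : ℤ) : ℝ) * 2 ^ k else 0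
    with hC
  have hsum : ∑ p ∈ Finset.powersetCard k (Finset.univ : Finset (Fin N)) ×ˢ
      (Finset.univ : Finset (Equiv.Perm (Fin N))), C p = ((gammaTerm α β N k : ℤ) : ℝ) * 2 ^ k := by
    rw [hC, Finset.sum_ite_eq', if_pos]
    simp [card_extremalSet hk]
  rw [← hsum]
  refine HasLeadingTerm.sum fun p hp => ?_
  obtain ⟨S, σ⟩ := p
  have hS : S.card = k := by simpa using hp
  have h := (HasLeadingTerm.const ((Equiv.Perm.sign σ : ℤ) : ℝ)).mul
    (hasLeadingTerm_mixedTerm hQ A B α β hm σ S)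
  rw [zero_add, hS] at h
  by_cases he : σ = extremalPerm N k ∧ S = extremalSet N k
  · obtain ⟨rfl, rfl⟩ := he
    rw [termVal_extremal hk] at h
    simp only [hC, if_true]
    convert! h using 1
    rw [sign_extremalPerm hk, gammaTerm]
    push_cast
    ring
  · have hlt := termVal_extremal_lt hm hS he
    have hne : ¬ ((S, σ) = (extremalSet N k, extremalPerm N k)) := fun h =>
      he ⟨congrArg Prod.snd h, congrArg Prod.fst h⟩
    simp only [hC, hne, if_false]
    refine h.zero_of_lt ?_
    rw [← termVal_extremal hk]
    have : (termVal m (extremalPerm N k) (extremalSet N k) : ℝ) < termVal m σ S := by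
      exact_mod_cast hlt
    nlinarith

/-- Among the parts of maximal amplitude the one of highest degree `j` decides the sign, because
its coefficient `2^j` exceeds `∑_{k < j} 2^k`. -/
lemma isPUltradiscrete_of_dominant {Q : ℝ} (hQ : Q < 0) (A B : ℝ) (α β : ℤˣ) {N j : ℕ}
    (hj : j ≤ N) {m : ℤ} (hm : m ≤ -2 * (N : ℤ) + 1)
    (hle : ∀ k < j, GTerm A B Q N k m ≤ GTerm A B Q N j m)
    (hlt : ∀ k, j < k → k ≤ N → GTerm A B Q N k m < GTerm A B Q N j m) :
    IsPUltradiscrete (gEps A B Q α β N m) (gammaTerm α β N j) (GTerm A B Q N j m) := by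
  set G := GTerm A B Q N j m with hG
  set C : ℕ → ℝ := fun k =>
    if GTerm A B Q N k m = G then ((gammaTerm α β N k : ℤ) : ℝ) * 2 ^ k else 0 with hC
  have hall : ∀ k ≤ N, GTerm A B Q N k m ≤ G := fun k hk => by
    rcases lt_trichotomy k j with h | rfl | h
    · exact hle k h
    · exact le_rfl
    · exact (hlt k h hk).le
  have hlead : HasLeadingTerm (gEps A B Q α β N m) (∑ k ∈ Finset.range (N + 1), C k) G := by
    have h := HasLeadingTerm.sum (s := Finset.range (N + 1)) (E := G) (C := C)
      (x := fun k => homogeneousPart A B Q α β N k m) fun k hk => by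
        have hk' : k ≤ N := Nat.lt_succ_iff.1 (Finset.mem_range.1 hk)
        exact (hasLeadingTerm_homogeneousPart hQ A B α β hk' hm).of_le (hall k hk')
    rwa [← funext fun ε => gEps_eq_sum A B Q α β N m ε] at h
  have hCj : C j = ((gammaTerm α β N j : ℤ) : ℝ) * 2 ^ j := if_pos rfl
  have hsum : ∑ k ∈ Finset.range (N + 1), C k = ∑ k ∈ Finset.range j, C k + C j := by
    rw [← Finset.sum_range_succ]
    refine (Finset.sum_subset (Finset.range_mono (by omega)) fun k hk hkj => ?_).symm
    simp only [Finset.mem_range] at hk hkj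
    exact if_neg (hlt k (by omega) (by omega)).ne
  have hrest : |∑ k ∈ Finset.range j, C k| < 2 ^ j := by
    have h2 : ∑ k ∈ Finset.range j, (2 : ℝ) ^ k = 2 ^ j - 1 := by
      rw [geom_sum_eq (by norm_num)]; norm_num
    have h1 : |∑ k ∈ Finset.range j, C k| ≤ ∑ k ∈ Finset.range j, (2 : ℝ) ^ k := by
      refine (Finset.abs_sum_le_sum_abs _ _).trans (Finset.sum_le_sum fun k _ => ?_)
      simp only [hC]
      split_ifs
      · rw [abs_mul, abs_units_cast, one_mul, abs_of_pos (by positivity)]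
      · rw [abs_zero]; positivity
    linarith
  refine ⟨((gammaTerm α β N j : ℤ) : ℝ) * ∑ k ∈ Finset.range (N + 1), C k, ?_, ?_⟩
  · rw [hsum, hCj]
    have := abs_lt.1 hrest
    rcases Int.units_eq_one_or (gammaTerm α β N j) with h | h <;> rw [h] <;> push_cast <;> linarith
  · refine (Tendsto.const_mul _ hlead).congr fun ε => ?_
    rw [Real.exp_neg, ← div_eq_mul_inv]
    rcases Int.units_eq_one_or (gammaTerm α β N j) with h | h <;> rw [h] <;> push_cast <;>
      field_simp

/-! ### Comparison of the amplitudes -/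

/-- The amplitude of degree `k` is at least that of degree `k - 1` if and only if
`crossing N k m * Q ≤ B - A`. -/
def crossing (N k : ℕ) (m : ℤ) : ℤ :=
  (m - N - 2 + 3 * k) ^ 2 - (N - k) * (N - k + 1)

lemma GTerm_succ_sub (A B Q : ℝ) (N k : ℕ) (m : ℤ) :
    GTerm A B Q N (k + 1) m - GTerm A B Q N k m = B - A - crossing N (k + 1) m * Q := by
  simp only [GTerm, crossing]
  push_cast
  ring

lemma crossing_antitone {N k i : ℕ} {m : ℤ} (hm : m ≤ -2 * (N : ℤ) + 1) (hki : k ≤ i)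
    (hi : i ≤ N) : crossing N i m ≤ crossing N k m := by
  induction i, hki using Nat.le_induction with
  | base => exact le_rfl
  | succ i _ ih =>
    refine le_trans ?_ (ih (by omega))
    simp only [crossing]
    push_cast
    have : (i : ℤ) + 1 ≤ N := by exact_mod_cast hi
    linarith

/-- As `crossing` decreases in `k`, the amplitude is maximal where the increments change sign. -/
lemma isPUltradiscrete_of_crossing {Q : ℝ} (hQ : Q < 0) {A B : ℝ} (α β : ℤˣ) {N j : ℕ}
    (hj : j ≤ N) {m : ℤ} (hm : m ≤ -2 * (N : ℤ) + 1)
    (hlow : j ≠ 0 → (crossing N j m : ℝ) * Q ≤ B - A)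
    (hupp : j ≠ N → B - A < crossing N (j + 1) m * Q) :
    IsPUltradiscrete (gEps A B Q α β N m) (gammaTerm α β N j) (GTerm A B Q N j m) := by
  have hcross {k i : ℕ} (hki : k ≤ i) (hi : i ≤ N) :
      (crossing N k m : ℝ) * Q ≤ crossing N i m * Q :=
    mul_le_mul_of_nonpos_right (by exact_mod_cast crossing_antitone hm hki hi) hQ.le
  refine isPUltradiscrete_of_dominant hQ A B α β hj hm (fun k hk => ?_) fun k hk hkN => ?_
  · refine monotoneOn_of_le_add_one (f := fun k => GTerm A B Q N k m) (s := Set.Iic j)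
      Set.ordConnected_Iic (fun i _ _ hi => ?_) (Set.mem_Iic.2 hk.le) (Set.mem_Iic.2 le_rfl) hk.le
    have h1 := GTerm_succ_sub A B Q N i m
    have h2 := hcross (show i + 1 ≤ j from hi) hj
    have h3 := hlow (by omega)
    linarith
  · induction k, hk using Nat.le_induction with
    | base =>
      have h1 := GTerm_succ_sub A B Q N j m
      have h2 := hupp (by omega)
      linarith
    | succ k hk ih =>
      have h1 := GTerm_succ_sub A B Q N k m
      have h2 := hcross (show j + 1 ≤ k + 1 by omega) hkN
      have h3 := hupp (by omega)
      have h4 := ih (by omega)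
      linarith

/-! ### Thresholds and blocks -/

lemma PThreshold_antitone {Q : ℝ} (hQ : Q < 0) {N : ℕ} {m₀ : ℤ}
    (hm₀ : (N : ℤ) * (N - 1) ≤ -2 * m₀ - 1) {i j : ℕ} (hij : i ≤ j) (hj : j ≤ N) :
    PThreshold Q N m₀ j ≤ PThreshold Q N m₀ i := by
  induction j, hij using Nat.le_induction with
  | base => exact le_rfl
  | succ j _ ih =>
    refine le_trans ?_ (ih (by omega))
    have hjN : ((j : ℝ) + 1) ≤ N := by exact_mod_cast hj
    rw [PThreshold, PThreshold, if_neg (by omega)]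
    split_ifs with h0
    · subst h0
      refine mul_le_mul_of_nonpos_right ?_ hQ.le
      have : (N : ℝ) * (N - 1) ≤ -2 * m₀ - 1 := by exact_mod_cast hm₀
      push_cast
      linarith
    · refine mul_le_mul_of_nonpos_right ?_ hQ.le
      push_cast
      linarith

lemma existsUnique_isThresholdIndex {A B Q : ℝ} (hQ : Q < 0) {N : ℕ} (hN : 1 ≤ N) {m₀ : ℤ}
    (hm₀ : (N : ℤ) * (N - 1) ≤ -2 * m₀ - 1) (hlow : (m₀ : ℝ) ^ 2 * Q ≤ B - A)
    (hupp : B - A < ((m₀ : ℝ) + 1) ^ 2 * Q) :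
    ∃! k₀ : ℕ, IsThresholdIndex A B Q N m₀ k₀ := by
  classical
  have hex : ∃ j, PThreshold Q N m₀ j ≤ B - A := ⟨N, by
    rw [PThreshold, if_neg (by omega)]
    simpa using hlow⟩
  have hN' : Nat.find hex ≤ N := Nat.find_min' hex (by
    rw [PThreshold, if_neg (by omega)]
    simpa using hlow)
  have hpos : Nat.find hex ≠ 0 := fun h0 => by
    have h := Nat.find_spec hex
    rw [h0, PThreshold, if_pos rfl] at h
    linarith
  have huniq {k k' : ℕ} (h : IsThresholdIndex A B Q N m₀ k)
      (h' : IsThresholdIndex A B Q N m₀ k') : k' ≤ k := by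
    by_contra hlt
    have := PThreshold_antitone hQ hm₀ (show k + 1 ≤ k' by omega) h'.1.le
    linarith [h.2.1, h'.2.2]
  refine ⟨Nat.find hex - 1, ⟨by omega, ?_, ?_⟩, fun k hk => ?_⟩
  · rw [Nat.sub_add_cancel (by omega)]
    exact Nat.find_spec hex
  · exact not_le.1 (Nat.find_min hex (by omega))
  · have hk0 : IsThresholdIndex A B Q N m₀ (Nat.find hex - 1) :=
      ⟨by omega, by rw [Nat.sub_add_cancel (by omega)]; exact Nat.find_spec hex,
        not_le.1 (Nat.find_min hex (by omega))⟩
    exact le_antisymm (huniq hk0 hk) (huniq hk hk0)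

lemma existsUnique_inBlock {N : ℕ} {m₀ m : ℤ} {k₀ : ℕ}
    (h1 : m₀ - 2 * (N : ℤ) + 3 ≤ m) (h2 : m ≤ m₀ + (N : ℤ) - 1) :
    ∃! j : ℕ, InBlock N m₀ k₀ j m := by
  obtain ⟨d, hd⟩ : ∃ d : ℕ, m = m₀ + N - d := ⟨(m₀ + N - m).toNat, by omega⟩
  have hex : ∃ j : ℕ, InBlock N m₀ k₀ j m := by
    unfold InBlock
    rcases lt_or_ge (d + 1) (3 * k₀) with h | h
    · exact ⟨(d + 1) / 3, by omega⟩
    · rcases le_or_gt d (3 * k₀) with h' | h'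
      · exact ⟨k₀, by omega⟩
      · exact ⟨(d + 2) / 3, by omega⟩
  obtain ⟨j, hj⟩ := hex
  refine ⟨j, hj, fun i hi => ?_⟩
  simp only [InBlock] at hi hj
  omega

/-- In the block with index `j` the integer `m` lies between the crossings `j` and `j + 1`. -/
lemma crossing_of_inBlock {A B Q : ℝ} (hQ : Q < 0) {N : ℕ} {m₀ m : ℤ}
    (hm₁ : m₀ ≤ -3 * (N : ℤ) + 1) (hm₀ : (N : ℤ) * (N - 1) ≤ -2 * m₀ - 2)
    (hlow : (m₀ : ℝ) ^ 2 * Q ≤ B - A) (hupp : B - A < ((m₀ : ℝ) + 1) ^ 2 * Q) {k₀ j : ℕ}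
    (hk₀ : IsThresholdIndex A B Q N m₀ k₀) (hj : InBlock N m₀ k₀ j m) :
    (j ≠ 0 → (crossing N j m : ℝ) * Q ≤ B - A) ∧
      (j ≠ N → B - A < crossing N (j + 1) m * Q) := by
  have hkN := hk₀.1
  have hjN : j + 1 ≤ N := by unfold InBlock at hj; omega
  have hjN' : (j : ℤ) + 1 ≤ N := by exact_mod_cast hjN
  have hj0 : (0 : ℤ) ≤ j := by positivity
  have hanti {x y : ℤ} (h : x ≤ y) : (y : ℝ) * Q ≤ x * Q :=
    mul_le_mul_of_nonpos_right (by exact_mod_cast h) hQ.le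
  have hlow' : ((m₀ ^ 2 : ℤ) : ℝ) * Q ≤ B - A := by push_cast; exact hlow
  have hupp' : B - A < (((m₀ + 1) ^ 2 : ℤ) : ℝ) * Q := by push_cast; exact hupp
  -- the thresholds as integer multiples of `Q`
  have hthr {i : ℕ} (hi : i ≠ 0) :
      PThreshold Q N m₀ i = ((m₀ ^ 2 - (N - i) * (N - i + 1) : ℤ) : ℝ) * Q := by
    rw [PThreshold, if_neg hi]; push_cast; ring
  have hPlow {i : ℕ} (h1 : k₀ + 1 ≤ i) (h2 : i ≤ N) :
      ((m₀ ^ 2 - (N - i) * (N - i + 1) : ℤ) : ℝ) * Q ≤ B - A := by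
    rw [← hthr (by omega)]
    exact (PThreshold_antitone hQ (by omega) h1 h2).trans hk₀.2.1
  have hPupp {i : ℕ} (h0 : i ≠ 0) (h1 : i ≤ k₀) :
      B - A < ((m₀ ^ 2 - (N - i) * (N - i + 1) : ℤ) : ℝ) * Q := by
    rw [← hthr h0]
    exact hk₀.2.2.trans_le (PThreshold_antitone hQ (by omega) h1 hkN.le)
  -- the offset of `m` in its block
  obtain ⟨r, hr⟩ : ∃ r : ℤ, m = m₀ + N - 3 * j + r := ⟨m - (m₀ + N - 3 * j), by ring⟩
  have hcj : crossing N j m = (m₀ - 2 + r) ^ 2 - (N - j) * (N - j + 1) := by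
    rw [crossing, hr]; ring
  have hcj1 : crossing N (j + 1) m = (m₀ + 1 + r) ^ 2 - (N - j - 1) * (N - j) := by
    rw [crossing, hr]; push_cast; ring
  have hprod : 0 ≤ ((N : ℤ) - j - 1) * (N - j) :=
    mul_nonneg (by linarith) (by linarith)
  rw [hcj, hcj1]
  rcases hj with ⟨h1, _, h3⟩ | ⟨h1, h3⟩ | ⟨h1, h3⟩
  · have hr0 : 0 ≤ r := by omega
    have hr2 : r ≤ 2 := by omega
    refine ⟨fun _ => (hanti ?_).trans (hPlow h1 (by omega)), fun _ => hupp'.trans_le (hanti ?_)⟩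
    · nlinarith [mul_nonneg (show 0 ≤ 2 - r by omega) (show 0 ≤ -2 * m₀ + 2 - r by omega)]
    · nlinarith [mul_nonneg hr0 (show 0 ≤ -2 * m₀ - 2 - r by omega)]
  · have hr0 : 0 ≤ r := by omega
    have hr1 : r ≤ 1 := by omega
    refine ⟨fun _ => (hanti ?_).trans (hPlow (i := j + 1) (by omega) hjN),
      fun _ => hupp'.trans_le (hanti ?_)⟩
    · push_cast
      nlinarith [mul_nonneg (show 0 ≤ 1 - r by omega) (show 0 ≤ -2 * m₀ + 3 - r by omega)]
    · nlinarith [mul_nonneg hr0 (show 0 ≤ -2 * m₀ - 2 - r by omega)]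
  · have hr0 : -1 ≤ r := by omega
    have hr1 : r ≤ 1 := by omega
    refine ⟨fun hne => (hanti ?_).trans hlow',
      fun _ => (hPupp (i := j + 1) (by omega) (by omega)).trans_le (hanti ?_)⟩
    · have hj1 : (1 : ℤ) ≤ j := by omega
      have : ((N : ℤ) - j) * (N - j + 1) ≤ N * (N - 1) := by nlinarith
      nlinarith [mul_nonneg (show 0 ≤ 1 - r by omega) (show 0 ≤ -2 * m₀ + 3 - r by omega)]
    · push_cast
      nlinarith [mul_nonneg (show 0 ≤ r + 1 by omega) (show 0 ≤ -2 * m₀ - 1 - r by omega)]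

end

theorem theorem2 (N : ℕ) (hN : 1 ≤ N) (A B Q : ℝ) (hQ : Q < 0) (α β : ℤˣ) (m₀ : ℤ)
    (hm₀ : m₀ ≤ min (-3 * (N : ℤ) + 1) (-((N : ℤ) * ((N : ℤ) - 1) / 2) - 1))
    (hlow : (m₀ : ℝ) ^ 2 * Q ≤ B - A) (hupp : B - A < ((m₀ : ℝ) + 1) ^ 2 * Q) :
    (∃! k₀ : ℕ, IsThresholdIndex A B Q N m₀ k₀) ∧
    ∀ k₀ : ℕ, IsThresholdIndex A B Q N m₀ k₀ →
      ∀ m : ℤ, m ≤ -2 * (N : ℤ) + 1 →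
        (m ≤ m₀ - 2 * (N : ℤ) + 2 →
          IsPUltradiscrete (gEps A B Q α β N m) (gammaTerm α β N N) (GTerm A B Q N N m)) ∧
        (m₀ - 2 * (N : ℤ) + 3 ≤ m → m ≤ m₀ + (N : ℤ) - 1 →
          (∃! j : ℕ, InBlock N m₀ k₀ j m) ∧
          ∀ j : ℕ, InBlock N m₀ k₀ j m →
            IsPUltradiscrete (gEps A B Q α β N m) (gammaTerm α β N j) (GTerm A B Q N j m)) ∧
        (m₀ + (N : ℤ) ≤ m →
          IsPUltradiscrete (gEps A B Q α β N m) (gammaTerm α β N 0) (GTerm A B Q N 0 m)) := by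
  have hm₁ : m₀ ≤ -3 * (N : ℤ) + 1 := hm₀.trans (min_le_left _ _)
  have hm₂ : (N : ℤ) * (N - 1) ≤ -2 * m₀ - 2 := by
    have h1 := hm₀.trans (min_le_right _ _)
    have h2 : 2 * ((N : ℤ) * (N - 1) / 2) = N * (N - 1) :=
      Int.mul_ediv_cancel' (Int.even_mul_pred_self _).two_dvd
    linarith
  have hanti {x y : ℤ} (h : x ≤ y) : (y : ℝ) * Q ≤ x * Q :=
    mul_le_mul_of_nonpos_right (by exact_mod_cast h) hQ.le
  refine ⟨existsUnique_isThresholdIndex hQ hN (by linarith) hlow hupp,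
    fun k₀ hk₀ m hm => ⟨fun h => ?_, fun h1 h2 => ⟨existsUnique_inBlock h1 h2,
      fun j hj => ?_⟩, fun h => ?_⟩⟩
  · refine isPUltradiscrete_of_crossing hQ α β le_rfl hm (fun _ => ?_) (fun h => absurd rfl h)
    refine (hanti (x := m₀ ^ 2) ?_).trans (by push_cast; exact hlow)
    rw [crossing]
    nlinarith
  · have hjN : j ≤ N := by have := hk₀.1; unfold InBlock at hj; omega
    have hc := crossing_of_inBlock hQ hm₁ hm₂ hlow hupp hk₀ hj
    exact isPUltradiscrete_of_crossing hQ α β hjN hm hc.1 hc.2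
  · refine isPUltradiscrete_of_crossing hQ α β (Nat.zero_le N) hm (fun h => absurd rfl h)
      (fun _ => ?_)
    refine lt_of_lt_of_le ?_ (hanti (y := (m₀ + 1) ^ 2) ?_)
    · push_cast; exact hupp
    · have hN' : (1 : ℤ) ≤ N := by exact_mod_cast hN
      have h1 : m₀ + 1 ≤ m - N + 1 := by linarith
      have h2 : m - N + 1 ≤ 0 := by linarith
      have h3 : (m - N + 1) ^ 2 ≤ (m₀ + 1) ^ 2 := by nlinarith
      have h4 : 0 ≤ (N : ℤ) * (N - 1) := mul_nonneg (by linarith) (by linarith)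
      rw [crossing]
      push_cast
      linarith
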